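/- Let $k$ be a field of characteristic different from $2$, let $1<d<n$ be integers, and let $f_0,\dots,f_d\in k[y_0,\dots,y_n]$ be quadratic forms that are linearly independent over $k$. Let $$\mathcal Q=\Big\{\sum_{i=0}^d x_0^{d-i}x_1^i f_i(y)=0\Big\}\subset\mathbb P^1_{(x_0,x_1)}\times\mathbb P^n_{(y_0,\dots,y_n)} .$$ For $z=(z_0,\dots,z_{d-1})\in k^d\setminus\{0\}$ let $X_z\subset\mathbb P^n$ be the closed subscheme defined by the $3\times 3$ minors of the $(d+1)\times 3$ matrix $$M_z=\begin{pmatrix}0&z_0&f_0\\-z_0&z_1&f_1\\ \vdots&\vdots&\vdots\\-z_{d-2}&z_{d-1}&f_{d-1}\\-z_{d-1}&0&f_d\end{pmatrix},$$ and for $0\le i\le d-1$ put $\rho_i=\sum_{j=0}^{i}x_0^{\,i-j}x_1^{\,d-1-i+j}f_j$. Consider the rational map $$\psi:\mathcal Q\dashrightarrow\mathbb P^{d-1}\times\mathbb P^n,\qquad ([x],[y])\mapsto([\rho_0:\dots:\rho_{d-1}],[y]).$$ A closed subscheme of a product of projective spaces over $k$ is called unirational if it is integral and there is, for some $N$, a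 dominant rational map over $k$ from $\mathbb P^N_k$ to it. Suppose that for some $z\in k^d\setminus\{0\}$ the scheme $X_z$ is a complete intersection of $d-1$ quadrics (it has codimension $d-1$ in $\mathbb P^n$ and its homogeneous ideal is generated by $d-1$ quadratic forms) and is unirational. Then $\mathcal Q$ is unirational. Moreover the strict transform $\widetilde X_z\subset\mathcal Q$ of $X_z$ under $\psi$, that is, the closure in $\mathbb P^1\times\mathbb P^n$ of the inverse image of $\{[z]\}\times X_z$ in the open subset of $\mathcal Q$ where $\rho_0,\dots,\rho_{d-1}$ do not all vanish, is a unirational subvariety of $\mathcal Q$ that dominates $\mathbb P^1$. -/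

import Mathlib

open MvPolynomial

/-! ### Closed subschemes of products of projective spaces over a field

A finite family of variables `σ` is cut into blocks by `b : σ → ι`.  The variables of the block
`i` are homogeneous coordinates on a projective space, and an ideal `I` of `k[σ]` which is
homogeneous in each block of variables defines a closed subscheme `V(I)` of the product, over
`i : ι`, of these projective spaces (over `k`). -/

section Multiprojective

variable {k σ ι : Type*} [Field k]

/-- The saturation `I : J^∞`, that is the union over `N` of the ideals `{p | p J^N ⊆ I}`. -/
noncomputable def saturationAlong {R : Type*} [CommRing R] (I J : Ideal R) : Ideal R :=
  ⨆ N : ℕ, Submodule.colon I ((J ^ N : Ideal R) : Set R)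

/-- The irrelevant ideal: the intersection, over the blocks, of the ideals generated by the
variables of one block. -/
noncomputable def irrelevantIdeal (k : Type*) [Field k] (b : σ → ι) :
    Ideal (MvPolynomial σ k) :=
  ⨅ i : ι, Ideal.span {p | ∃ s, b s = i ∧ p = X s}

/-- The ideal of all the equations of the closed subscheme `V(I)`: the saturation of `I` with
respect to the irrelevant ideal. -/
noncomputable def schemeIdeal (b : σ → ι) (I : Ideal (MvPolynomial σ k)) :
    Ideal (MvPolynomial σ k) :=
  saturationAlong I (irrelevantIdeal k b)

/-- `V(I)` is an integral (in particular non-empty) scheme. -/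
def IsIntegralSubscheme (b : σ → ι) (I : Ideal (MvPolynomial σ k)) : Prop :=
  (schemeIdeal b I).IsPrime

/-- The polynomials `φ s` in `N + 1` variables are the coordinates of a rational map from `ℙ^N`
to the product of projective spaces given by `b`: in each block they are forms of one common
degree, not all zero. -/
def IsRationalMap {N : ℕ} (b : σ → ι) (φ : σ → MvPolynomial (Fin (N + 1)) k) : Prop :=
  ∀ i : ι, (∃ e : ℕ, ∀ s, b s = i → (φ s).IsHomogeneous e) ∧ ∃ s, b s = i ∧ φ s ≠ 0

/-- The ideal of the closure of the image of the rational map with coordinates `φ`: the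
polynomials that vanish identically on the multicone over the image, i.e. at all the points
`s ↦ T_{b s} φ_s`, with one free scaling parameter `T_i` for each block `i`. -/
noncomputable def imageIdeal {N : ℕ} (b : σ → ι) (φ : σ → MvPolynomial (Fin (N + 1)) k) :
    Ideal (MvPolynomial σ k) :=
  RingHom.ker (aeval (R := k)
    (fun s => (X (Sum.inl (b s)) * rename Sum.inr (φ s) :
      MvPolynomial (ι ⊕ Fin (N + 1)) k))).toRingHom

/-- `V(I)` is a unirational variety over `k`: it is integral, and for some `N` there is a
rational map over `k` from `ℙ^N` whose image is contained and dense in it. -/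
def IsUnirational (b : σ → ι) (I : Ideal (MvPolynomial σ k)) : Prop :=
  IsIntegralSubscheme b I ∧
    ∃ (N : ℕ) (φ : σ → MvPolynomial (Fin (N + 1)) k),
      IsRationalMap b φ ∧ imageIdeal b φ = schemeIdeal b I

end Multiprojective

/-- The block structure of `ℙ^n`: one block of `n + 1` variables. -/
def projBlock (n : ℕ) : Fin (n + 1) → Unit := fun _ => ()

/-- The block structure of `ℙ^1 × ℙ^n`, with coordinates `x_i = X (Sum.inl i)` and
`y_j = X (Sum.inr j)`. -/
def biprojBlock (n : ℕ) : Fin 2 ⊕ Fin (n + 1) → Fin 2 := Sum.elim (fun _ => 0) (fun _ => 1)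

section Divisor

variable {k : Type*} [Field k] {n d : ℕ}

/-- `V(I) ⊆ ℙ^n` is a complete intersection of `c` quadrics: it has codimension `c`, and its
homogeneous ideal is generated by `c` quadratic forms. -/
def IsCompleteIntersectionOfQuadrics (I : Ideal (MvPolynomial (Fin (n + 1)) k)) (c : ℕ) : Prop :=
  (schemeIdeal (projBlock n) I).height = c ∧
    ∃ q : Fin c → MvPolynomial (Fin (n + 1)) k,
      (∀ i, (q i).IsHomogeneous 2) ∧ schemeIdeal (projBlock n) I = Ideal.span (Set.range q)

/-- The first projection from `V(I) ⊆ ℙ^1 × ℙ^n` to `ℙ^1` is dominant: no non-zero polynomial in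
`x_0, x_1` alone vanishes on `V(I)`. -/
def DominatesLine (I : Ideal (MvPolynomial (Fin 2 ⊕ Fin (n + 1)) k)) : Prop :=
  (schemeIdeal (biprojBlock n) I).comap
    (rename Sum.inl : MvPolynomial (Fin 2) k →ₐ[k] MvPolynomial (Fin 2 ⊕ Fin (n + 1)) k) = ⊥

/-- The form `∑ x_0^{d-i} x_1^i f_i` on `ℙ^1 × ℙ^n`. -/
noncomputable def divisorForm (f : Fin (d + 1) → MvPolynomial (Fin (n + 1)) k) :
    MvPolynomial (Fin 2 ⊕ Fin (n + 1)) k :=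
  ∑ i : Fin (d + 1),
    X (Sum.inl 0) ^ (d - (i : ℕ)) * X (Sum.inl 1) ^ (i : ℕ) * rename Sum.inr (f i)

/-- The matrix with columns `(0, -z_0, …, -z_{d-1})`, `(z_0, …, z_{d-1}, 0)`, `(f_0, …, f_d)`. -/
noncomputable def ottMatrix (f : Fin (d + 1) → MvPolynomial (Fin (n + 1)) k) (z : Fin d → k) :
    Matrix (Fin (d + 1)) (Fin 3) (MvPolynomial (Fin (n + 1)) k) :=
  Matrix.of fun i =>
    ![Fin.cons (α := fun _ => MvPolynomial (Fin (n + 1)) k) 0 (fun j => -C (z j)) i,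
      Fin.snoc (α := fun _ => MvPolynomial (Fin (n + 1)) k) (fun j => C (z j)) 0 i,
      f i]

/-- The ideal of the `3 × 3` minors of the matrix; it defines `X_z ⊆ ℙ^n`. -/
noncomputable def minorIdeal (f : Fin (d + 1) → MvPolynomial (Fin (n + 1)) k) (z : Fin d → k) :
    Ideal (MvPolynomial (Fin (n + 1)) k) :=
  Ideal.span (Set.range fun r : Fin 3 → Fin (d + 1) => ((ottMatrix f z).submatrix r id).det)

/-- The form `ρ_i = ∑_{j ≤ i} x_0^{i-j} x_1^{d-1-(i-j)} f_j`. -/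
noncomputable def rhoForm (f : Fin (d + 1) → MvPolynomial (Fin (n + 1)) k) (i : Fin d) :
    MvPolynomial (Fin 2 ⊕ Fin (n + 1)) k :=
  ∑ j : Fin d with j ≤ i,
    X (Sum.inl 0) ^ ((i : ℕ) - (j : ℕ)) * X (Sum.inl 1) ^ (d - 1 - ((i : ℕ) - (j : ℕ))) *
      rename Sum.inr (f j.castSucc)

/-- The equations, inside `ℙ^1 × ℙ^n` and away from the common zeros of the `ρ_i`, of the inverse
image of `{[z]} × X_z` under the rational map `ψ = ([ρ_0 : … : ρ_{d-1}], y)` from the divisor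
`divisorForm f = 0` to `ℙ^{d-1} × ℙ^n`: the equation of the divisor, the proportionality of
`(ρ_0, …, ρ_{d-1})` and `z`, and the equations of `X_z` in the variables `y`. -/
noncomputable def preimageIdeal (f : Fin (d + 1) → MvPolynomial (Fin (n + 1)) k) (z : Fin d → k) :
    Ideal (MvPolynomial (Fin 2 ⊕ Fin (n + 1)) k) :=
  Ideal.span {divisorForm f} ⊔
    Ideal.span {p | ∃ i j : Fin d, p = C (z i) * rhoForm f j - C (z j) * rhoForm f i} ⊔
    (minorIdeal f z).map
      (rename Sum.inr : MvPolynomial (Fin (n + 1)) k →ₐ[k] MvPolynomial (Fin 2 ⊕ Fin (n + 1)) k)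

/-- The ideal of the strict transform of `X_z` under `ψ`: the closure in `ℙ^1 × ℙ^n` of the inverse
image of `{[z]} × X_z` in the open set where some `ρ_i` does not vanish. -/
noncomputable def strictTransformIdeal (f : Fin (d + 1) → MvPolynomial (Fin (n + 1)) k)
    (z : Fin d → k) : Ideal (MvPolynomial (Fin 2 ⊕ Fin (n + 1)) k) :=
  saturationAlong (preimageIdeal f z) (Ideal.span (Set.range (rhoForm f)))

end Divisor

/-! Write `a`, `b` for the first two columns of the matrix and `Z = ∑ z_j x_0^{d-1-j} x_1^j`
(`binaryForm`). On `X_z` the third column is a combination of the other two: `f_i = a_i λ + b_i μ`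
with quadratic forms `λ`, `μ` (`exists_columnCombination`). Since `∑ x_0^{d-i} x_1^i a_i = -x_1 Z`
and `∑ x_0^{d-i} x_1^i b_i = x_0 Z`, the equation of the divisor restricts to `(μ x_0 - λ x_1) Z` on
`ℙ^1 × X_z`. The strict transform is the closure of the graph of `[λ : μ]` on `X_z`, so a
parametrisation `φ` of `X_z` gives one of it (`mem_strictTransformIdeal`). A dimension count in the
space of quadratic forms (`span_eq_of_card`, `normalForm`) makes `λ`, `μ` linearly independent
modulo the ideal of `X_z`. Hence `u = λ(φ)/μ(φ)` is transcendental over `k` (`transcendental_div`),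
and the strict transform dominates `ℙ^1`.

The strict transform is thus a unirational multisection of the quadric bundle. After base change to
the function field of the parameter space, the quadric over `u` contains the point `φ`. Projection
from `φ` parametrises this quadric once it is irreducible and `φ` is not a vertex; as `u` is
transcendental, the base-changed bundle dominates the divisor.

Not a vertex (`exists_bundleGram_ne_zero`): let `M(x)` be the Gram matrix of the pencil. If `M(u)φ =
0`, then `φᵀ M'(u) φ = 0` by symmetry (`sum_derivative_eq_zero`). But `φᵀ M(x) φ = (μ(φ) x - λ(φ))
Z(x, 1)` has a simple zero at `u`.

Irreducible (`prime_bundlePoly`): divide `λ(φ)`, `μ(φ)` by their gcd to get coprime `a`, `b`, and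
suppose the form over `[a : b]` is a product of two linear forms. Modulo a prime factor `π` of `Z(a,
b)` the form vanishes on `X_z`, which is integral and in no hyperplane, so a linear factor vanishes
modulo `π`. Linear independence of the `f_i` then forces `π` to divide both `a` and `b`.

The ideal of the image is computed in `mem_span_divisorForm_iff`: the residual-point map fixes the
points of the quadric where the polar form of `φ` is non-zero, so an equation of the image is
divisible by the quadric, and this divisibility descends to `k[x, y]` (`divisorForm_dvd`). -/

/-! ### Coefficientwise linear maps -/

section CoeffMap

variable {σ τ R S : Type*} [CommRing R] [CommRing S] [Algebra R S]

/-- The map between polynomial rings that applies a linear map to every coefficient. -/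
noncomputable def coeffMap (σ : Type*) (θ : S →ₗ[R] R) (p : MvPolynomial σ S) : MvPolynomial σ R :=
  ∑ m ∈ p.support, monomial m (θ (coeff m p))

theorem coeff_coeffMap (θ : S →ₗ[R] R) (p : MvPolynomial σ S) (m : σ →₀ ℕ) :
    coeff m (coeffMap σ θ p) = θ (coeff m p) := by
  classical
  simp only [coeffMap, coeff_sum, coeff_monomial]
  rw [Finset.sum_ite_eq']
  split_ifs with h
  · rfl
  · rw [notMem_support_iff.mp h, map_zero]

theorem coeffMap_zero (θ : S →ₗ[R] R) : coeffMap σ θ 0 = 0 := by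
  ext m; simp [coeff_coeffMap]

theorem coeffMap_add (θ : S →ₗ[R] R) (p q : MvPolynomial σ S) :
    coeffMap σ θ (p + q) = coeffMap σ θ p + coeffMap σ θ q := by
  ext m; simp [coeff_coeffMap]

theorem coeffMap_sum {ι : Type*} (s : Finset ι) (θ : S →ₗ[R] R) (p : ι → MvPolynomial σ S) :
    coeffMap σ θ (∑ i ∈ s, p i) = ∑ i ∈ s, coeffMap σ θ (p i) := by
  ext m; simp [coeff_coeffMap, coeff_sum]

/-- Linearity over polynomials with coefficients in `R`: this is what lets linear relations and
divisibility descend from `S` to `R`. -/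
theorem coeffMap_mul_map (θ : S →ₗ[R] R) (q : MvPolynomial σ S) (f : MvPolynomial σ R) :
    coeffMap σ θ (q * map (algebraMap R S) f) = coeffMap σ θ q * f := by
  classical
  ext m
  simp only [coeff_coeffMap, coeff_mul, coeff_map, map_sum]
  refine Finset.sum_congr rfl fun x _ => ?_
  rw [mul_comm, ← Algebra.smul_def, map_smul, smul_eq_mul, mul_comm]

theorem coeffMap_C (θ : S →ₗ[R] R) (s : S) : coeffMap σ θ (C s) = C (θ s) := by
  classical
  ext m
  simp only [coeff_coeffMap, coeff_C]
  split_ifs <;> simp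

theorem coeffMap_C_mul_map (θ : S →ₗ[R] R) (s : S) (f : MvPolynomial σ R) :
    coeffMap σ θ (C s * map (algebraMap R S) f) = C (θ s) * f := by
  rw [coeffMap_mul_map, coeffMap_C]

theorem totalDegree_coeffMap_le (θ : S →ₗ[R] R) (p : MvPolynomial σ S) :
    (coeffMap σ θ p).totalDegree ≤ p.totalDegree := by
  refine Finset.sup_mono fun m hm => ?_
  rw [mem_support_iff, coeff_coeffMap] at hm
  rw [mem_support_iff]
  exact fun h => hm (by rw [h, map_zero])

theorem coeffMap_eval₂ (θ : S →ₗ[R] R) (ψ : σ → MvPolynomial τ R) (p : MvPolynomial σ S) :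
    coeffMap τ θ (eval₂ C (fun s => map (algebraMap R S) (ψ s)) p) = aeval ψ (coeffMap σ θ p) := by
  induction p using MvPolynomial.induction_on' with
  | monomial m s =>
    have h : (monomial m s : MvPolynomial σ S) = C s * map (algebraMap R S) (monomial m 1) := by
      simp [C_mul_monomial]
    have h2 : eval₂ C (fun s => map (algebraMap R S) (ψ s)) (map (algebraMap R S) (monomial m 1)) =
        map (algebraMap R S) (aeval ψ (monomial m (1 : R))) := by
      rw [map_monomial, eval₂_monomial, aeval_monomial]
      simp [Finsupp.prod]
    rw [h, eval₂_mul, eval₂_C, h2, coeffMap_C_mul_map, coeffMap_C_mul_map, map_mul, aeval_C,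
      MvPolynomial.algebraMap_eq]
  | add p q hp hq => rw [eval₂_add, coeffMap_add, hp, hq, coeffMap_add, map_add]

end CoeffMap

/-! ### Descent of linear relations and divisibility to the base field -/

section Field

variable {k S σ τ : Type*} [Field k] [CommRing S] [Algebra k S]

theorem eq_zero_of_forall_coeffMap_eq_zero {p : MvPolynomial σ S}
    (h : ∀ θ : S →ₗ[k] k, coeffMap σ θ p = 0) : p = 0 := by
  ext m
  rw [coeff_zero, ← Module.forall_dual_apply_eq_zero_iff k]
  intro θ
  rw [← coeff_coeffMap, h θ, coeff_zero]

/-- Polynomials that are linearly independent over a field remain so over every algebra. -/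
theorem eq_zero_of_sum_C_mul_map_eq_zero {ι : Type*} [Fintype ι] {f : ι → MvPolynomial σ k}
    (hf : LinearIndependent k f) {s : ι → S}
    (h : ∑ i, C (s i) * map (algebraMap k S) (f i) = 0) (i : ι) : s i = 0 := by
  rw [← Module.forall_dual_apply_eq_zero_iff k]
  intro θ
  refine Fintype.linearIndependent_iff.mp hf (fun i => θ (s i)) ?_ i
  have := congrArg (coeffMap σ θ) h
  rw [coeffMap_sum, coeffMap_zero] at this
  simpa only [coeffMap_C_mul_map, MvPolynomial.smul_eq_C_mul] using this

/-- If no non-zero polynomial of degree at most one over a field vanishes at `ψ`, then the same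
holds over every algebra. -/
theorem eq_zero_of_eval₂_eq_zero {ψ : σ → MvPolynomial τ k}
    (hψ : ∀ p : MvPolynomial σ k, p.totalDegree ≤ 1 → aeval ψ p = 0 → p = 0)
    {p : MvPolynomial σ S} (hp : p.totalDegree ≤ 1)
    (h : eval₂ C (fun s => map (algebraMap k S) (ψ s)) p = 0) : p = 0 := by
  refine eq_zero_of_forall_coeffMap_eq_zero (k := k) fun θ =>
    hψ _ ((totalDegree_coeffMap_le θ p).trans hp) ?_
  rw [← coeffMap_eval₂, h, coeffMap_zero]

/-- Divisibility of polynomials descends along an extension of a domain by a field, up to a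
constant. -/
theorem exists_dvd_C_mul_of_map_dvd_map {R E : Type*} [CommRing R] [IsDomain R] [Field E]
    {f : R →+* E} (hf : Function.Injective f) {p q : MvPolynomial σ R}
    (h : map f p ∣ map f q) : ∃ c : R, c ≠ 0 ∧ p ∣ C c * q := by
  classical
  let K := FractionRing R
  let g : K →+* E := IsFractionRing.lift hf
  let _ : Algebra K E := g.toAlgebra
  -- A `K`-linear retraction of `E` onto `K`, applied to the coefficients of the quotient, moves the
  -- divisibility to `K`; it remains to clear denominators.
  obtain ⟨θ, hθ⟩ := (Algebra.linearMap K E).exists_leftInverse_of_injective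
    (LinearMap.ker_eq_bot.mpr (algebraMap K E).injective)
  have hθ1 : θ 1 = 1 := by simpa using LinearMap.congr_fun hθ 1
  have hfg : f = (algebraMap K E).comp (algebraMap R K) := by
    ext r
    exact (IsFractionRing.lift_algebraMap hf r).symm
  obtain ⟨r, hr⟩ := h
  rw [hfg, ← map_map, ← map_map, mul_comm] at hr
  have h1 := congrArg (coeffMap σ θ) hr
  rw [coeffMap_mul_map, ← one_mul (map (algebraMap K E) _), coeffMap_mul_map,
    ← C_1, coeffMap_C, hθ1, C_1, one_mul] at h1
  obtain ⟨c, hc⟩ := IsLocalization.exist_integer_multiples_of_finset (nonZeroDivisors R)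
    ((coeffMap σ θ r).support.image fun m => coeff m (coeffMap σ θ r))
  have hcr : ∃ r' : MvPolynomial σ R,
      map (algebraMap R K) r' = C (algebraMap R K c) * coeffMap σ θ r := by
    refine mem_range_map_iff_coeffs_subset.mpr ?_
    intro x hx
    rw [Finset.mem_coe, mem_coeffs_iff] at hx
    obtain ⟨m, hm, rfl⟩ := hx
    rw [coeff_C_mul]
    have hm' : m ∈ (coeffMap σ θ r).support := by
      rw [mem_support_iff, coeff_C_mul] at hm
      exact mem_support_iff.mpr (right_ne_zero_of_mul hm)
    obtain ⟨y, hy⟩ := hc _ (Finset.mem_image_of_mem _ hm')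
    exact ⟨y, by rw [hy, Algebra.smul_def]⟩
  obtain ⟨r', hr'⟩ := hcr
  refine ⟨c, nonZeroDivisors.ne_zero c.2, r', ?_⟩
  apply map_injective _ (IsFractionRing.injective R K)
  rw [map_mul, map_mul, map_C, h1, hr']
  ring

end Field

/-! ### Homogeneous polynomials -/

section Homogeneous

variable {k S σ : Type*} [CommRing k] [CommRing S] [Algebra k S]

theorem aeval_mul_of_isHomogeneous {f : MvPolynomial σ k} {e : ℕ} (hf : f.IsHomogeneous e)
    (T : S) (v : σ → S) : aeval (fun s => T * v s) f = T ^ e * aeval v f := by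
  simp only [aeval_def, eval₂_eq, Finset.mul_sum]
  refine Finset.sum_congr rfl fun m hm => ?_
  have hm' : ∑ i ∈ m.support, m i = e := by
    by_contra h
    exact mem_support_iff.mp hm (hf.coeff_eq_zero h)
  simp only [mul_pow, Finset.prod_mul_distrib, Finset.prod_pow_eq_pow_sum, hm']
  ring

end Homogeneous

/-! ### Saturations and parametrised varieties -/

section Saturation

theorem saturationAlong_le {R : Type*} [CommRing R] {I J K : Ideal R} (hK : K.IsPrime)
    (hI : I ≤ K) (hJ : ¬ J ≤ K) : saturationAlong I J ≤ K := by
  refine iSup_le fun N p hp => ?_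
  by_contra hpK
  refine hJ (fun x hx => ?_)
  have h := hI (Submodule.mem_colon.mp hp (x ^ N) (Ideal.pow_mem_pow hx N))
  exact hK.mem_of_pow_mem N ((hK.mem_or_mem h).resolve_left hpK)

theorem le_saturationAlong {R : Type*} [CommRing R] (I J : Ideal R) : I ≤ saturationAlong I J :=
  le_trans (fun _ hp => Submodule.mem_colon.mpr fun q _ => I.mul_mem_right q hp)
    (le_iSup (fun N : ℕ => Submodule.colon I ((J ^ N : Ideal R) : Set R)) 0)

theorem saturationAlong_eq_self {R : Type*} [CommRing R] {K J : Ideal R} (hK : K.IsPrime)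
    (hJ : ¬ J ≤ K) : saturationAlong K J = K :=
  le_antisymm (saturationAlong_le hK le_rfl hJ) (le_saturationAlong K J)

/-- The exponents may depend on `i`: an ideal that is finitely generated and lies in the radical of
the colon ideal has a single power inside it. -/
theorem mem_saturationAlong_span {R : Type*} [CommRing R] {I : Ideal R} {ι : Type*} [Finite ι]
    {r : ι → R} {p : R} (h : ∀ i, ∃ N : ℕ, p * r i ^ N ∈ I) :
    p ∈ saturationAlong I (Ideal.span (Set.range r)) := by
  have hle : Ideal.span (Set.range r) ≤ (Submodule.colon I {p}).radical := by
    rw [Ideal.span_le]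
    rintro _ ⟨i, rfl⟩
    obtain ⟨N, hN⟩ := h i
    refine ⟨N, Submodule.mem_colon_singleton.mpr ?_⟩
    rwa [smul_eq_mul, mul_comm]
  obtain ⟨N, hN⟩ := Ideal.exists_pow_le_of_le_radical_of_fg hle
    ⟨(Set.finite_range r).toFinset, by simp⟩
  refine le_iSup (fun N : ℕ => Submodule.colon I
    ((Ideal.span (Set.range r) ^ N : Ideal R) : Set R)) N (Submodule.mem_colon.mpr fun q hq => ?_)
  have := Submodule.mem_colon_singleton.mp (hN hq)
  rwa [smul_eq_mul, mul_comm] at this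

variable {k σ ι τ : Type*} [Field k]

/-- Criterion for unirationality: a parametrisation by forms in a finite set of variables whose
ideal of relations is the given ideal. -/
theorem isUnirational_of_parametrization [Finite ι] [Fintype τ] [Nonempty τ] {b : σ → ι}
    {φ : σ → MvPolynomial τ k}
    (hφ : ∀ i : ι, (∃ e : ℕ, ∀ s, b s = i → (φ s).IsHomogeneous e) ∧ ∃ s, b s = i ∧ φ s ≠ 0)
    {I : Ideal (MvPolynomial σ k)}
    (hI : ∀ p, p ∈ I ↔ aeval (fun s => (X (Sum.inl (b s)) * rename Sum.inr (φ s) :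
      MvPolynomial (ι ⊕ τ) k)) p = 0) :
    schemeIdeal b I = I ∧ IsUnirational b I := by
  classical
  have := Fintype.ofFinite ι
  have hprime : I.IsPrime := by
    have : I = RingHom.ker (aeval (R := k) (fun s => (X (Sum.inl (b s)) * rename Sum.inr (φ s) :
      MvPolynomial (ι ⊕ τ) k))).toRingHom := by
      ext p
      rw [hI, RingHom.mem_ker]
      rfl
    rw [this]
    exact RingHom.ker_isPrime _
  have hirr : ¬ irrelevantIdeal k b ≤ I := by
    intro hle
    choose s hs hs0 using fun i => (hφ i).2
    -- The product of one coordinate from each block lies in every block ideal, yet its value under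
    -- the parametrisation is a product of non-zero polynomials.
    have hmem : ∏ i, (X (s i) : MvPolynomial σ k) ∈ irrelevantIdeal k b := by
      rw [irrelevantIdeal, Ideal.mem_iInf]
      intro i
      exact Ideal.mem_of_dvd _ (Finset.dvd_prod_of_mem _ (Finset.mem_univ i))
        (Ideal.subset_span ⟨s i, hs i, rfl⟩)
    have h0 := (hI _).mp (hle hmem)
    rw [map_prod, Finset.prod_eq_zero_iff] at h0
    obtain ⟨i, -, hi⟩ := h0
    rw [aeval_X, mul_eq_zero] at hi
    rcases hi with hi | hi
    · exact X_ne_zero _ hi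
    · rw [map_eq_zero_iff _ (rename_injective _ Sum.inr_injective)] at hi
      exact hs0 i hi
  have hsat : schemeIdeal b I = I := saturationAlong_eq_self hprime hirr
  refine ⟨hsat, ?_, ?_⟩
  · rw [IsIntegralSubscheme, hsat]
    exact hprime
  obtain ⟨N, hN⟩ : ∃ N, Fintype.card τ = N + 1 :=
    Nat.exists_eq_succ_of_ne_zero Fintype.card_ne_zero
  let e : τ ≃ Fin (N + 1) := Fintype.equivFinOfCardEq hN
  refine ⟨N, fun s => rename e (φ s), fun i => ⟨?_, ?_⟩, ?_⟩
  · obtain ⟨d, hd⟩ := (hφ i).1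
    exact ⟨d, fun s hs => (hd s hs).rename_isHomogeneous⟩
  · obtain ⟨s, hs, h0⟩ := (hφ i).2
    exact ⟨s, hs, by rwa [Ne, map_eq_zero_iff _ (rename_injective _ e.injective)]⟩
  · rw [hsat]
    ext p
    rw [hI, imageIdeal, RingHom.mem_ker]
    have : aeval (R := k) (fun s => (X (Sum.inl (b s)) * rename Sum.inr (rename e (φ s)) :
        MvPolynomial (ι ⊕ Fin (N + 1)) k)) =
        (rename (Sum.map id e)).comp (aeval (R := k) (fun s =>
          (X (Sum.inl (b s)) * rename Sum.inr (φ s) : MvPolynomial (ι ⊕ τ) k))) := by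
      ext s
      simp only [aeval_X, AlgHom.comp_apply, map_mul, rename_X, rename_rename, Sum.map_inl, id]
      rfl
    change aeval _ p = 0 ↔ _
    rw [this, AlgHom.comp_apply, map_eq_zero_iff _ (rename_injective _
      (Sum.map_injective.mpr ⟨Function.injective_id, e.injective⟩))]

end Saturation

/-! ### Ideals generated by quadratic forms -/

section QuadricIdeal

variable {k σ : Type*} [Field k]

theorem homogeneousComponent_mul_of_isHomogeneous {q : MvPolynomial σ k} {m : ℕ}
    (hq : q.IsHomogeneous m) (r : MvPolynomial σ k) (n : ℕ) :
    homogeneousComponent n (r * q) = if m ≤ n then homogeneousComponent (n - m) r * q else 0 := by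
  conv_lhs => rw [← sum_homogeneousComponent r, Finset.sum_mul, map_sum]
  have h : ∀ i, homogeneousComponent n (homogeneousComponent i r * q) =
      if n = i + m then homogeneousComponent i r * q else 0 := fun i =>
    homogeneousComponent_of_mem ((homogeneousComponent_isHomogeneous i r).mul hq)
  simp only [h]
  split_ifs with hmn
  · have : ∀ i, (n = i + m) ↔ (i = n - m) := fun i => by omega
    simp only [this, Finset.sum_ite_eq', Finset.mem_range]
    split_ifs with hlt
    · rfl
    · rw [homogeneousComponent_eq_zero _ _ (by omega), zero_mul]
  · refine Finset.sum_eq_zero fun i _ => ?_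
    rw [if_neg (by omega)]

variable {c : ℕ} {q : Fin c → MvPolynomial σ k}

theorem homogeneousComponent_eq_zero_of_mem_span (hq : ∀ i, (q i).IsHomogeneous 2)
    {p : MvPolynomial σ k} (hp : p ∈ Ideal.span (Set.range q)) {n : ℕ} (hn : n < 2) :
    homogeneousComponent n p = 0 := by
  obtain ⟨r, rfl⟩ := Ideal.mem_span_range_iff_exists_fun.mp hp
  rw [map_sum]
  refine Finset.sum_eq_zero fun i _ => ?_
  rw [homogeneousComponent_mul_of_isHomogeneous (hq i), if_neg (by omega)]

theorem eq_zero_of_mem_span_of_totalDegree_le_one (hq : ∀ i, (q i).IsHomogeneous 2)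
    {p : MvPolynomial σ k} (hp : p ∈ Ideal.span (Set.range q)) (hdeg : p.totalDegree ≤ 1) :
    p = 0 := by
  rw [← sum_homogeneousComponent p]
  refine Finset.sum_eq_zero fun i hi => ?_
  rw [Finset.mem_range] at hi
  exact homogeneousComponent_eq_zero_of_mem_span hq hp (by omega)

/-- In the degree 2 component of `∑ r_i q_i` only the constant terms of the `r_i` survive. -/
theorem mem_span_of_mem_ideal_span (hq : ∀ i, (q i).IsHomogeneous 2)
    {p : MvPolynomial σ k} (hp : p ∈ Ideal.span (Set.range q)) (hp2 : p.IsHomogeneous 2) :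
    p ∈ Submodule.span k (Set.range q) := by
  obtain ⟨r, hr⟩ := Ideal.mem_span_range_iff_exists_fun.mp hp
  have h := homogeneousComponent_of_mem (m := 2) hp2
  rw [if_pos rfl] at h
  rw [← h, ← hr, map_sum]
  refine Submodule.sum_mem _ fun i _ => ?_
  rw [homogeneousComponent_mul_of_isHomogeneous (hq i), if_pos le_rfl, Nat.sub_self,
    homogeneousComponent_zero, ← MvPolynomial.smul_eq_C_mul]
  exact Submodule.smul_mem _ _ (Submodule.subset_span ⟨i, rfl⟩)

/-- A dimension count: if the linearly independent forms `f₀, …, f_d` lie in the span of `g` and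
of two more elements, and `g` lies in the span of `d - 1` elements `q`, then the spans of `g` and of
`q` agree and do not contain a non-trivial combination of the two elements. -/
theorem span_eq_of_card {V ι : Type*} [AddCommGroup V] [Module k V] {d : ℕ} (hd : 1 < d)
    {f : Fin (d + 1) → V} (hf : LinearIndependent k f) {g : ι → V} {q : Fin (d - 1) → V} {l m : V}
    (hfg : ∀ i, f i ∈ Submodule.span k (Set.range g) ⊔ Submodule.span k {l, m})
    (hgq : ∀ i, g i ∈ Submodule.span k (Set.range q)) :
    Submodule.span k (Set.range q) = Submodule.span k (Set.range g) ∧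
      ∀ c c' : k, c • l + c' • m ∈ Submodule.span k (Set.range q) → c = 0 ∧ c' = 0 := by
  classical
  set F := Submodule.span k (Set.range f) with hF
  set G := Submodule.span k (Set.range g) with hG
  set Q := Submodule.span k (Set.range q) with hQ
  have hQfin : FiniteDimensional k Q := FiniteDimensional.span_of_finite k (Set.finite_range q)
  have hlm : FiniteDimensional k (Submodule.span k {l, m}) :=
    FiniteDimensional.span_of_finite k (Set.toFinite _)
  have hGQ : G ≤ Q := Submodule.span_le.mpr (by rintro _ ⟨i, rfl⟩; exact hgq i)
  have hGfin : FiniteDimensional k G := Submodule.finiteDimensional_of_le hGQ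
  have hFG : F ≤ G ⊔ Submodule.span k {l, m} :=
    Submodule.span_le.mpr (by rintro _ ⟨i, rfl⟩; exact hfg i)
  have hFdim : Module.finrank k F = d + 1 := by
    rw [hF, finrank_span_eq_card hf, Fintype.card_fin]
  have hQdim : Module.finrank k Q ≤ d - 1 := by
    simpa [Set.finrank] using finrank_range_le_card (R := k) q
  have hlmdim : Module.finrank k (Submodule.span k {l, m}) ≤ 2 := by
    have h := finrank_span_finset_le_card (R := k) ({l, m} : Finset V)
    rw [Set.finrank, Finset.coe_pair] at h
    exact h.trans Finset.card_le_two
  have h1 := Submodule.finrank_mono hFG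
  have h2 := Submodule.finrank_add_le_finrank_add_finrank G (Submodule.span k {l, m})
  -- The inequalities `d + 1 ≤ dim G + 2` and `dim G ≤ dim Q ≤ d - 1` leave no room.
  have hGQe : G = Q := Submodule.eq_of_le_of_finrank_le hGQ (by omega)
  refine ⟨hGQe.symm, fun c c' hc => ?_⟩
  by_contra hne
  -- Modulo `Q`, a non-trivial relation makes one of `l`, `m` superfluous, so `F` would have
  -- dimension at most `(d - 1) + 1`.
  obtain ⟨v, hv⟩ : ∃ v : V, Submodule.span k {l, m} ≤ Q ⊔ Submodule.span k {v} := by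
    by_cases hc0 : c = 0
    · have hc' : c' ≠ 0 := fun h => hne ⟨hc0, h⟩
      refine ⟨l, Submodule.span_le.mpr ?_⟩
      rintro x (rfl | hx)
      · exact Submodule.mem_sup_right (Submodule.mem_span_singleton_self _)
      · rw [Set.mem_singleton_iff] at hx
        subst hx
        rw [hc0, zero_smul, zero_add] at hc
        exact Submodule.mem_sup_left ((Submodule.smul_mem_iff _ hc').mp hc)
    · refine ⟨m, Submodule.span_le.mpr ?_⟩
      rintro x (rfl | hx)
      · refine (Submodule.smul_mem_iff _ hc0).mp ?_
        have : c • x = (c • x + c' • m) + (-c') • m := by module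
        rw [this]
        exact Submodule.add_mem _ (Submodule.mem_sup_left hc)
          (Submodule.mem_sup_right (Submodule.smul_mem _ _ (Submodule.mem_span_singleton_self _)))
      · rw [Set.mem_singleton_iff] at hx
        subst hx
        exact Submodule.mem_sup_right (Submodule.mem_span_singleton_self _)
  have h3 : F ≤ Q ⊔ Submodule.span k {v} := hFG.trans (sup_le (hGQ.trans le_sup_left) hv)
  have h4 := Submodule.finrank_mono h3
  have h5 := Submodule.finrank_add_le_finrank_add_finrank Q (Submodule.span k {v})
  have h6 : Module.finrank k (Submodule.span k {v}) ≤ 1 := by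
    simpa using finrank_span_le_card (R := k) ({v} : Set V)
  omega

end QuadricIdeal

/-! ### The first two columns of the matrix -/

section Columns

variable {d : ℕ} {S : Type*} [CommRing S]

/-- The column `(0, -z_0, …, -z_{d-1})`. -/
def lowerColumn (z : Fin d → S) : Fin (d + 1) → S :=
  Fin.cons (α := fun _ => S) 0 fun j => -z j

/-- The column `(z_0, …, z_{d-1}, 0)`. -/
def upperColumn (z : Fin d → S) : Fin (d + 1) → S :=
  Fin.snoc (α := fun _ => S) z 0

/-- The binary form `∑ z_j x^{d-1-j} y^j`. -/
def binaryForm (z : Fin d → S) (x y : S) : S :=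
  ∑ j : Fin d, x ^ (d - 1 - (j : ℕ)) * y ^ (j : ℕ) * z j

/-- With `sum_upperColumn` this gives the factorisation on `X_z`: replacing `f_i` by `a_i λ + b_i μ`
turns the equation of the divisor into `(μ x - λ y)` times the binary form. -/
theorem sum_lowerColumn (z : Fin d → S) (x y : S) :
    ∑ i : Fin (d + 1), x ^ (d - (i : ℕ)) * y ^ (i : ℕ) * lowerColumn z i =
      -(y * binaryForm z x y) := by
  rw [Fin.sum_univ_succ, binaryForm, Finset.mul_sum, ← Finset.sum_neg_distrib]
  simp only [lowerColumn, Fin.cons_zero, Fin.cons_succ, mul_zero, zero_add, Fin.val_succ]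
  refine Finset.sum_congr rfl fun j _ => ?_
  rw [show d - (j + 1 : ℕ) = d - 1 - (j : ℕ) by omega]
  ring

theorem sum_upperColumn (z : Fin d → S) (x y : S) :
    ∑ i : Fin (d + 1), x ^ (d - (i : ℕ)) * y ^ (i : ℕ) * upperColumn z i =
      x * binaryForm z x y := by
  rw [Fin.sum_univ_castSucc, binaryForm, Finset.mul_sum]
  simp only [upperColumn, Fin.snoc_last, Fin.snoc_castSucc, mul_zero, add_zero, Fin.val_castSucc]
  refine Finset.sum_congr rfl fun j _ => ?_
  have := j.2
  rw [show d - (j : ℕ) = d - 1 - (j : ℕ) + 1 by omega]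
  ring

theorem map_lowerColumn {T : Type*} [CommRing T] (g : S →+* T) (z : Fin d → S) (i : Fin (d + 1)) :
    g (lowerColumn z i) = lowerColumn (fun j => g (z j)) i := by
  refine Fin.cases ?_ (fun j => ?_) i <;> simp [lowerColumn]

theorem map_upperColumn {T : Type*} [CommRing T] (g : S →+* T) (z : Fin d → S) (i : Fin (d + 1)) :
    g (upperColumn z i) = upperColumn (fun j => g (z j)) i := by
  refine Fin.lastCases ?_ (fun j => ?_) i <;> simp [upperColumn]

theorem map_binaryForm {T : Type*} [CommRing T] (g : S →+* T) (z : Fin d → S) (x y : S) :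
    g (binaryForm z x y) = binaryForm (fun j => g (z j)) (g x) (g y) := by
  simp [binaryForm]

end Columns

/-! ### Normal form of the equations of `X_z` -/

section NormalForm

variable {k : Type*} [Field k] {n d : ℕ}

theorem exists_min_ne_zero {z : Fin d → k} (hz : z ≠ 0) :
    ∃ m : Fin d, z m ≠ 0 ∧ ∀ j < m, z j = 0 := by
  classical
  obtain ⟨i, hi⟩ := Function.ne_iff.mp hz
  obtain ⟨m, hm, hmin⟩ := WellFounded.has_min (wellFounded_lt (α := Fin d)) {j | z j ≠ 0} ⟨i, hi⟩
  exact ⟨m, hm, fun j hj => by_contra fun h => hmin j h hj⟩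

/-- On `X_z` the forms `f_i` are combinations `a_i λ + b_i μ` of two quadratic forms `λ` and `μ`,
where `a` and `b` are the first two columns of the matrix. -/
theorem exists_columnCombination {f : Fin (d + 1) → MvPolynomial (Fin (n + 1)) k}
    (hf : ∀ i, (f i).IsHomogeneous 2) {z : Fin d → k} (hz : z ≠ 0) :
    ∃ l m : MvPolynomial (Fin (n + 1)) k, l.IsHomogeneous 2 ∧ m.IsHomogeneous 2 ∧
      ∀ i, f i - (C (lowerColumn z i) * l + C (upperColumn z i) * m) ∈ minorIdeal f z := by
  -- For the first non-zero entry `z_t`, the rows `t` and `t + 1` of the first two columns are `(0,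
  -- z_t)` and `(-z_t, b)`, with determinant `z_t ^ 2`. Cramer's rule with these rows determines `λ`
  -- and `μ`, and the minors with a third row `i` give the relations.
  obtain ⟨t, ht, hmin⟩ := exists_min_ne_zero hz
  have hlow : lowerColumn z t.castSucc = 0 := by
    rcases t with ⟨_ | t, htd⟩
    · rfl
    · have : (⟨t + 1, htd⟩ : Fin d).castSucc = Fin.succ ⟨t, by omega⟩ := rfl
      rw [this]
      simp only [lowerColumn, Fin.cons_succ, neg_eq_zero]
      exact hmin _ (Fin.mk_lt_mk.mpr (Nat.lt_succ_self t))
  have hup : upperColumn z t.castSucc = z t := by simp [upperColumn]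
  have hlow' : lowerColumn z t.succ = -z t := by simp [lowerColumn]
  set b := upperColumn z t.succ with hb
  have hzz : (C (z t) : MvPolynomial (Fin (n + 1)) k) * C (z t)⁻¹ = 1 := by
    rw [← C_mul, mul_inv_cancel₀ ht, C_1]
  have hmin' : ∀ i, C (z t) * (C (z t) * f i) -
      (C (lowerColumn z i) * (C b * f t.castSucc - C (z t) * f t.succ) +
        C (upperColumn z i) * (C (z t) * f t.castSucc)) ∈ minorIdeal f z := by
    intro i
    have hmem : ((ottMatrix f z).submatrix ![t.castSucc, t.succ, i] id).det ∈ minorIdeal f z :=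
      Ideal.subset_span ⟨_, rfl⟩
    have hrow : ∀ i, ottMatrix f z i = ![C (lowerColumn z i), C (upperColumn z i), f i] := by
      intro i
      rw [map_lowerColumn, map_upperColumn]
      simp only [ottMatrix, lowerColumn, upperColumn]
      rfl
    convert hmem using 1
    rw [Matrix.det_fin_three]
    simp only [Matrix.submatrix_apply, id, Matrix.cons_val_zero, Matrix.cons_val_one,
      Matrix.cons_val, hrow, hlow, hup, hlow', ← hb, C_0, C_neg]
    ring
  refine ⟨C ((z t)⁻¹ * (z t)⁻¹) * (C b * f t.castSucc - C (z t) * f t.succ),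
    C (z t)⁻¹ * f t.castSucc, (((hf _).C_mul _).sub ((hf _).C_mul _)).C_mul _, (hf _).C_mul _,
    fun i => ?_⟩
  have := (minorIdeal f z).mul_mem_left (C ((z t)⁻¹ * (z t)⁻¹)) (hmin' i)
  convert this using 1
  rw [C_mul]
  linear_combination (-(C (z t) * C (z t)⁻¹ + 1) * f i +
    C (upperColumn z i) * (C (z t)⁻¹ * f t.castSucc)) * hzz

/-- The consequences of the hypothesis that `X_z` is an integral complete intersection of
quadrics. -/
theorem normalForm (hd : 1 < d) {f : Fin (d + 1) → MvPolynomial (Fin (n + 1)) k}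
    (hf : ∀ i, (f i).IsHomogeneous 2) (hlin : LinearIndependent k f) {z : Fin d → k} (hz : z ≠ 0)
    (hci : IsCompleteIntersectionOfQuadrics (minorIdeal f z) (d - 1)) :
    schemeIdeal (projBlock n) (minorIdeal f z) = minorIdeal f z ∧
      (∀ p ∈ minorIdeal f z, p.totalDegree ≤ 1 → p = 0) ∧
      ∃ l m : MvPolynomial (Fin (n + 1)) k, l.IsHomogeneous 2 ∧ m.IsHomogeneous 2 ∧
        (∀ i, f i - (C (lowerColumn z i) * l + C (upperColumn z i) * m) ∈ minorIdeal f z) ∧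
        ∀ c c' : k, C c * l + C c' * m ∈ minorIdeal f z → c = 0 ∧ c' = 0 := by
  obtain ⟨-, q, hq, hspan⟩ := hci
  obtain ⟨l, m, hl, hm, hlm⟩ := exists_columnCombination hf hz
  set g : Fin (d + 1) → MvPolynomial (Fin (n + 1)) k := fun i =>
    f i - (C (lowerColumn z i) * l + C (upperColumn z i) * m) with hg
  have hle : minorIdeal f z ≤ Ideal.span (Set.range q) := hspan ▸ le_saturationAlong _ _
  have hg2 : ∀ i, (g i).IsHomogeneous 2 := fun i =>
    (hf i).sub ((hl.C_mul _).add (hm.C_mul _))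
  obtain ⟨h1, h2⟩ := span_eq_of_card hd hlin (g := g) (q := q) (l := l) (m := m)
    (fun i => by
      have : f i = g i + (lowerColumn z i • l + upperColumn z i • m) := by
        simp only [hg, MvPolynomial.smul_eq_C_mul]
        ring
      rw [this]
      exact Submodule.add_mem_sup (Submodule.subset_span ⟨i, rfl⟩)
        (Submodule.add_mem _ (Submodule.smul_mem _ _ (Submodule.subset_span (by simp)))
          (Submodule.smul_mem _ _ (Submodule.subset_span (by simp)))))
    (fun i => mem_span_of_mem_ideal_span hq (hle (hlm i)) (hg2 i))
  -- The quadrics `q` span the same space as the `g_i`, which are already in the ideal of minors; so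
  -- that ideal is saturated.
  have hge : Ideal.span (Set.range q) ≤ minorIdeal f z := by
    rw [Ideal.span_le]
    rintro _ ⟨i, rfl⟩
    have hqi : q i ∈ Submodule.span k (Set.range g) := h1 ▸ Submodule.subset_span ⟨i, rfl⟩
    have : Submodule.span k (Set.range g) ≤ (minorIdeal f z).restrictScalars k :=
      Submodule.span_le.mpr (by rintro _ ⟨i, rfl⟩; exact hlm i)
    exact this hqi
  have heq : Ideal.span (Set.range q) = minorIdeal f z := le_antisymm hge hle
  refine ⟨hspan.trans heq, fun p hp hdeg => ?_, l, m, hl, hm, hlm, fun c c' hc => h2 c c' ?_⟩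
  · exact eq_zero_of_mem_span_of_totalDegree_le_one hq (hle hp) hdeg
  · rw [MvPolynomial.smul_eq_C_mul, MvPolynomial.smul_eq_C_mul]
    exact mem_span_of_mem_ideal_span hq (hle hc) ((hl.C_mul _).add (hm.C_mul _))

end NormalForm

/-! ### Algebraic independence of two linearly independent forms -/

section Independence

variable {k : Type*} [Field k]

/-- A quotient of two linearly independent polynomials is transcendental. -/
theorem transcendental_div {τ E : Type*} [Field E] [Algebra (MvPolynomial τ k) E]
    [IsFractionRing (MvPolynomial τ k) E] [Algebra k E] [IsScalarTower k (MvPolynomial τ k) E]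
    {A B : MvPolynomial τ k} (h : ∀ c c' : k, C c * A + C c' * B = 0 → c = 0 ∧ c' = 0) :
    Transcendental k (algebraMap (MvPolynomial τ k) E A / algebraMap (MvPolynomial τ k) E B) := by
  have hA : A ≠ 0 := fun h0 => one_ne_zero (h 1 0 (by simp [h0])).1
  have hB : B ≠ 0 := fun h0 => one_ne_zero (h 0 1 (by simp [h0])).2
  have hinj := IsFractionRing.injective (MvPolynomial τ k) E
  have hA' : algebraMap (MvPolynomial τ k) E A ≠ 0 := by simpa using hA
  have hB' : algebraMap (MvPolynomial τ k) E B ≠ 0 := by simpa using hB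
  intro halg
  -- Polynomial rings are integrally closed. Applied to the quotient and to its inverse, this makes
  -- the quotient a unit of the polynomial ring, hence a constant, against linear independence.
  have key : ∀ x : E, IsAlgebraic k x → ∃ y, algebraMap (MvPolynomial τ k) E y = x := fun x hx =>
    IsIntegrallyClosed.isIntegral_iff.mp (hx.isIntegral.tower_top (A := MvPolynomial τ k))
  obtain ⟨g, hg⟩ := key _ halg
  obtain ⟨g', hg'⟩ := key _ halg.inv
  have hunit : g * g' = 1 := by
    apply hinj
    rw [map_mul, hg, hg', map_one, mul_inv_cancel₀ (div_ne_zero hA' hB')]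
  obtain ⟨r, -, hr⟩ := isUnit_iff_eq_C_of_isReduced.mp (IsUnit.of_mul_eq_one _ hunit)
  have hAB : A = C r * B := by
    apply hinj
    rw [map_mul, ← hr, hg, div_mul_cancel₀ _ hB']
  exact one_ne_zero (h 1 (-r) (by rw [hAB]; simp)).1

/-- If `A / B` is transcendental, then `A T` and `B T` are algebraically independent. -/
theorem eq_zero_of_aeval_binary {R E : Type*} [CommRing R] [IsDomain R] [Algebra k R] [Field E]
    [Algebra R E] [IsFractionRing R E] [Algebra k E] [IsScalarTower k R E] {A B : R}
    (hB : B ≠ 0) (h : Transcendental k (algebraMap R E A / algebraMap R E B))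
    {G : MvPolynomial (Fin 2) k}
    (hG : aeval ![Polynomial.X * Polynomial.C A, Polynomial.X * Polynomial.C B] G = 0) : G = 0 := by
  set u := algebraMap R E A / algebraMap R E B with hu
  have hB' : algebraMap R E B ≠ 0 := by simpa using hB
  have hcc : Polynomial.C (algebraMap R E B) * Polynomial.C (algebraMap R E B)⁻¹ = 1 := by
    rw [← Polynomial.C_mul, mul_inv_cancel₀ hB', Polynomial.C_1]
  -- Rescaling the free variable `T` by `B⁻¹` replaces `(A T, B T)` by `(u T, T)`. Then `u` is
  -- replaced by an indeterminate, and the pair specialises to the two variables of `G` via `T ↦ X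
  -- 1`, `u ↦ X 0 / X 1`.
  have h1 : aeval ![Polynomial.X * Polynomial.C u, Polynomial.X] G = 0 := by
    have := congrArg ((Polynomial.aeval (R := R)
      (Polynomial.X * Polynomial.C (algebraMap R E B)⁻¹ : Polynomial E)).restrictScalars k) hG
    rw [map_zero, comp_aeval_apply] at this
    rw [← this]
    congr 2
    ext i : 1
    fin_cases i
    · simp only [hu, Polynomial.algebraMap_apply, div_eq_mul_inv, Fin.zero_eta,
        Matrix.cons_val_zero, AlgHom.restrictScalars_apply, map_mul,
        Polynomial.aeval_X, Polynomial.aeval_C]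
      ring
    · simp only [Polynomial.algebraMap_apply, Fin.mk_one, Matrix.cons_val_one, Matrix.cons_val_zero,
        AlgHom.restrictScalars_apply, map_mul, Polynomial.aeval_X, Polynomial.aeval_C]
      linear_combination -Polynomial.X * hcc
  have h2 : aeval ![Polynomial.X * Polynomial.C Polynomial.X, Polynomial.X] G =
      (0 : Polynomial (Polynomial k)) := by
    have hinj : Function.Injective 
        (Polynomial.mapAlgHom (Polynomial.aeval u : Polynomial k →ₐ[k] E)) :=
      Polynomial.map_injective (Polynomial.aeval u : Polynomial k →ₐ[k] E).toRingHom
        (transcendental_iff_injective.mp h)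
    apply hinj
    rw [map_zero, comp_aeval_apply, ← h1]
    congr 2
    ext i : 1
    fin_cases i <;> simp
  let g : MvPolynomial (Fin 2) k →ₐ[k] FractionRing (MvPolynomial (Fin 2) k) :=
    IsScalarTower.toAlgHom k _ _
  have hg : Function.Injective g := IsFractionRing.injective _ _
  have hX : g (X 1) ≠ 0 := (map_ne_zero_iff g hg).mpr (X_ne_zero _)
  have h3 := congrArg (Polynomial.aevalTower (Polynomial.aeval (g (X 0) / g (X 1))) (g (X 1))) h2
  rw [map_zero, comp_aeval_apply] at h3
  apply hg
  rw [map_zero, ← h3]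
  conv_lhs => rw [← aeval_X_left_apply G, comp_aeval_apply]
  congr 2
  ext i : 1
  fin_cases i
  · simp [hX]
  · simp

end Independence

/-! ### The forms `ρ_i` on `X_z` -/

section Rho

variable {d : ℕ} {S : Type*} [CommRing S]

/-- Extension of a finite sequence by zero. -/
def extendZero (z : Fin d → S) (j : ℕ) : S := if h : j < d then z ⟨j, h⟩ else 0

theorem extendZero_val (z : Fin d → S) (j : Fin d) : extendZero z j = z j := by
  simp [extendZero]

/-- The form `∑_{j < i} z_j x^{i-1-j} y^{d-1-i+j}`. -/
def truncatedForm (z : Fin d → S) (x y : S) (i : ℕ) : S :=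
  ∑ j ∈ Finset.range i, x ^ (i - 1 - j) * y ^ (d - 1 - (i - j)) * extendZero z j

/-- Horner's recursion for the truncated forms: passing from `i` to `i + 1` adds one term and shifts
one exponent from `y` to `x`. -/
theorem mul_truncatedForm_succ (z : Fin d → S) (x y : S) {i : ℕ} (hi : i + 1 < d) :
    y * truncatedForm z x y (i + 1) = x * truncatedForm z x y i + extendZero z i * y ^ (d - 1) := by
  rw [truncatedForm, Finset.sum_range_succ, truncatedForm, mul_add, Finset.mul_sum, Finset.mul_sum]
  congr 1
  · refine Finset.sum_congr rfl fun j hj => ?_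
    rw [Finset.mem_range] at hj
    rw [show i + 1 - 1 - j = i - 1 - j + 1 by omega,
      show d - 1 - (i - j) = d - 1 - (i + 1 - j) + 1 by omega]
    ring
  · have h : y ^ (d - 1) = y * y ^ (d - 1 - 1) := by
      rw [← pow_succ']
      congr 1
      omega
    rw [show i + 1 - 1 - i = 0 by omega, show i + 1 - i = 1 by omega, h]
    ring

/-- The last step of the same recursion. The binary form takes the place of `y` times the next
truncated form, which would need an exponent `-1`. -/
theorem binaryForm_eq_truncatedForm (z : Fin d → S) (x y : S) (hd : 0 < d) :
    binaryForm z x y = x * truncatedForm z x y (d - 1) + extendZero z (d - 1) * y ^ (d - 1) := by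
  have h : binaryForm z x y =
      ∑ j ∈ Finset.range d, x ^ (d - 1 - j) * y ^ j * extendZero z j := by
    rw [← Fin.sum_univ_eq_sum_range (fun j => x ^ (d - 1 - j) * y ^ j * extendZero z j), binaryForm]
    simp only [extendZero_val]
  obtain ⟨e, rfl⟩ : ∃ e, d = e + 1 := ⟨d - 1, by omega⟩
  rw [h, Finset.sum_range_succ, truncatedForm, Finset.mul_sum]
  simp only [Nat.add_sub_cancel, Nat.sub_self]
  congr 1
  · refine Finset.sum_congr rfl fun j hj => ?_
    rw [Finset.mem_range] at hj
    rw [show e - (e - j) = j by omega, show e - j = e - 1 - j + 1 by omega]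
    ring
  · ring

theorem sum_fin_filter_le {M : Type*} [AddCommMonoid M] (h : ℕ → M) (i : Fin d) :
    ∑ j : Fin d with j ≤ i, h j = ∑ j ∈ Finset.range (i + 1), h j := by
  rw [Finset.sum_filter]
  have := Fin.sum_univ_eq_sum_range (fun j => if j ≤ (i : ℕ) then h j else 0) d
  refine Eq.trans this ?_
  rw [← Finset.sum_filter]
  refine Finset.sum_congr ?_ fun _ _ => rfl
  ext j
  have := i.2
  simp only [Finset.mem_filter, Finset.mem_range]
  omega

/-- The lower column is the upper one shifted by one place and negated. After reindexing, the terms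
with the same `z_j` combine to a multiple of `m x - l y`; only the upper term with `j = i` stays
unpaired. -/
theorem sum_rho (z : Fin d → S) (x y l m : S) (i : Fin d) :
    ∑ j : Fin d with j ≤ i, x ^ ((i : ℕ) - (j : ℕ)) * y ^ (d - 1 - ((i : ℕ) - (j : ℕ))) *
      (lowerColumn z j.castSucc * l + upperColumn z j.castSucc * m) =
    m * y ^ (d - 1) * z i + (m * x - l * y) * truncatedForm z x y i := by
  let w : ℕ → S := fun j => Nat.casesOn j 0 fun j => extendZero z j
  have hlow : ∀ j : Fin d, lowerColumn z j.castSucc = -w j := by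
    rintro ⟨_ | j, hj⟩
    · simp [w, lowerColumn]
    · have : (⟨j + 1, hj⟩ : Fin d).castSucc = Fin.succ ⟨j, by omega⟩ := rfl
      rw [this]
      simp only [lowerColumn, Fin.cons_succ, w]
      exact congrArg Neg.neg (extendZero_val z ⟨j, by omega⟩).symm
  have hup : ∀ j : Fin d, upperColumn z j.castSucc = extendZero z j := by
    intro j
    simp [upperColumn, extendZero_val]
  simp only [hlow, hup]
  rw [sum_fin_filter_le (fun j => x ^ ((i : ℕ) - j) * y ^ (d - 1 - ((i : ℕ) - j)) *
    (-w j * l + extendZero z j * m))]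
  simp only [mul_add, Finset.sum_add_distrib]
  rw [Finset.sum_range_succ', Finset.sum_range_succ, truncatedForm, Finset.mul_sum]
  have h0 : w 0 = 0 := rfl
  have hw : ∀ j, w (j + 1) = extendZero z j := fun _ => rfl
  simp only [h0, hw, Nat.sub_self, pow_zero, extendZero_val]
  have : ∀ j ∈ Finset.range (i : ℕ), (m * x - l * y) *
      (x ^ ((i : ℕ) - 1 - j) * y ^ (d - 1 - ((i : ℕ) - j)) * extendZero z j) =
      x ^ ((i : ℕ) - (j + 1)) * y ^ (d - 1 - ((i : ℕ) - (j + 1))) * (-extendZero z j * l) +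
      x ^ ((i : ℕ) - j) * y ^ (d - 1 - ((i : ℕ) - j)) * (extendZero z j * m) := by
    intro j hj
    have := i.2
    rw [Finset.mem_range] at hj
    rw [show (i : ℕ) - (j + 1) = i - 1 - j by omega, show (i : ℕ) - j = i - 1 - j + 1 by omega,
      show d - 1 - ((i : ℕ) - 1 - j) = d - 1 - (i - 1 - j + 1) + 1 by omega]
    ring
  rw [Finset.sum_congr rfl this, Finset.sum_add_distrib]
  simp only [Nat.sub_zero]
  ring

/-- In a ring where `ρ_i = μ y^{d-1} z_i + L c_i` with `L = μ x - λ y`, an ideal that contains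
`L Z` and the minors of `(ρ, z)` contains the products `L ρ_i`. -/
theorem mul_rho_mem {z : Fin d → S} {x y l m : S} {ρ : Fin d → S}
    (hρ : ∀ i, ρ i = m * y ^ (d - 1) * z i + (m * x - l * y) * truncatedForm z x y i)
    {t : Fin d} (ht : IsUnit (z t)) (hmin : ∀ j < t, z j = 0) {P : Ideal S}
    (hD : (m * x - l * y) * binaryForm z x y ∈ P)
    (hP : ∀ i j, z i * ρ j - z j * ρ i ∈ P) (i : Fin d) : (m * x - l * y) * ρ i ∈ P := by
  -- As `c_t = 0`, the minor of `(ρ, z)` with indices `t`, `i` reduces to `z_t L c_i`, which puts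
  -- each `L c_i` in `P`.
  have hct : truncatedForm z x y t = 0 := by
    refine Finset.sum_eq_zero fun j hj => ?_
    rw [Finset.mem_range] at hj
    have hjd : j < d := hj.trans t.2
    rw [extendZero, dif_pos hjd, hmin ⟨j, hjd⟩ hj, mul_zero]
  have hLc : ∀ i : Fin d, (m * x - l * y) * truncatedForm z x y i ∈ P := by
    intro i
    have := hP t i
    rw [hρ, hρ, hct] at this
    refine (Ideal.unit_mul_mem_iff_mem P ht).mp ?_
    convert this using 1
    ring
  have hLy : (m * x - l * y) * y ^ (d - 1) ∈ P := by
    refine (Ideal.unit_mul_mem_iff_mem P ht).mp ?_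
    -- The recursion gives `z_t y^{d-1} = y c_{t+1}`. For `t = d - 1` there is no `c_{t+1}`, and
    -- `z_t y^{d-1}` is the binary form itself, so the equation of the divisor is needed.
    by_cases htd : (t : ℕ) + 1 < d
    · have h1 := mul_truncatedForm_succ z x y htd
      rw [hct, mul_zero, zero_add, extendZero_val] at h1
      have h2 := P.mul_mem_left y (hLc ⟨t + 1, htd⟩)
      convert h2 using 1
      linear_combination (-(m * x - l * y)) * h1
    · have htd' : (t : ℕ) = d - 1 := by have := t.2; omega
      have h1 := binaryForm_eq_truncatedForm z x y (by have := t.2; omega)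
      rw [← htd', hct, mul_zero, zero_add, extendZero_val] at h1
      rw [← htd']
      convert hD using 1
      rw [h1]
      ring
  have h3 : (m * x - l * y) * ρ i = m * z i * ((m * x - l * y) * y ^ (d - 1)) +
      (m * x - l * y) * ((m * x - l * y) * truncatedForm z x y i) := by
    rw [hρ]
    ring
  rw [h3]
  exact P.add_mem (P.mul_mem_left _ hLy) (P.mul_mem_left _ (hLc i))

end Rho

/-! ### Evaluation of the forms -/

section Evaluation

variable {k : Type*} [Field k] {n d : ℕ} {S : Type*} [CommRing S] [Algebra k S]

theorem aeval_divisorForm (f : Fin (d + 1) → MvPolynomial (Fin (n + 1)) k)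
    (v : Fin 2 ⊕ Fin (n + 1) → S) :
    aeval v (divisorForm f) = ∑ i : Fin (d + 1),
      v (Sum.inl 0) ^ (d - (i : ℕ)) * v (Sum.inl 1) ^ (i : ℕ) *
        aeval (fun j => v (Sum.inr j)) (f i) := by
  simp [divisorForm, aeval_rename, Function.comp_def]

theorem aeval_rhoForm (f : Fin (d + 1) → MvPolynomial (Fin (n + 1)) k)
    (v : Fin 2 ⊕ Fin (n + 1) → S) (i : Fin d) :
    aeval v (rhoForm f i) = ∑ j : Fin d with j ≤ i,
      v (Sum.inl 0) ^ ((i : ℕ) - (j : ℕ)) * v (Sum.inl 1) ^ (d - 1 - ((i : ℕ) - (j : ℕ))) *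
        aeval (fun j => v (Sum.inr j)) (f j.castSucc) := by
  simp [rhoForm, aeval_rename, Function.comp_def]

theorem aeval_divisorForm_of_columns {f : Fin (d + 1) → MvPolynomial (Fin (n + 1)) k} {z : Fin d → k}
    {v : Fin 2 ⊕ Fin (n + 1) → S} {l m : S}
    (h : ∀ i, aeval (fun j => v (Sum.inr j)) (f i) =
      algebraMap k S (lowerColumn z i) * l + algebraMap k S (upperColumn z i) * m) :
    aeval v (divisorForm f) = (m * v (Sum.inl 0) - l * v (Sum.inl 1)) *
      binaryForm (fun j => algebraMap k S (z j)) (v (Sum.inl 0)) (v (Sum.inl 1)) := by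
  rw [aeval_divisorForm]
  have h1 := sum_lowerColumn (fun j => algebraMap k S (z j)) (v (Sum.inl 0)) (v (Sum.inl 1))
  have h2 := sum_upperColumn (fun j => algebraMap k S (z j)) (v (Sum.inl 0)) (v (Sum.inl 1))
  simp only [← map_lowerColumn, ← map_upperColumn] at h1 h2
  simp only [h, mul_add, ← mul_assoc, Finset.sum_add_distrib, ← Finset.sum_mul, h1, h2]
  ring

theorem aeval_rhoForm_of_columns {f : Fin (d + 1) → MvPolynomial (Fin (n + 1)) k} {z : Fin d → k}
    {v : Fin 2 ⊕ Fin (n + 1) → S} {l m : S}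
    (h : ∀ i, aeval (fun j => v (Sum.inr j)) (f i) =
      algebraMap k S (lowerColumn z i) * l + algebraMap k S (upperColumn z i) * m) (i : Fin d) :
    aeval v (rhoForm f i) = m * v (Sum.inl 1) ^ (d - 1) * algebraMap k S (z i) +
      (m * v (Sum.inl 0) - l * v (Sum.inl 1)) *
        truncatedForm (fun j => algebraMap k S (z j)) (v (Sum.inl 0)) (v (Sum.inl 1)) i := by
  rw [aeval_rhoForm]
  refine Eq.trans ?_ (sum_rho (fun j => algebraMap k S (z j)) _ _ l m i)
  simp only [h, map_lowerColumn, map_upperColumn]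

end Evaluation

/-! ### Parametrisation of the strict transform -/

section StrictTransform

variable {k : Type*} [Field k] {n d N : ℕ}

/-- The variety `X_z`, on which `f_i = a_i λ + b_i μ`, is the closure of the image of the rational
map with coordinates `φ`. -/
structure IsColumnParametrization (f : Fin (d + 1) → MvPolynomial (Fin (n + 1)) k) (z : Fin d → k)
    (l m : MvPolynomial (Fin (n + 1)) k) (φ : Fin (n + 1) → MvPolynomial (Fin (N + 1)) k) :
    Prop where
  one_lt : 1 < d
  isHomogeneous : ∀ i, (f i).IsHomogeneous 2
  linearIndependent : LinearIndependent k f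
  ne_zero : z ≠ 0
  isHomogeneous_l : l.IsHomogeneous 2
  isHomogeneous_m : m.IsHomogeneous 2
  column : ∀ i, f i - (C (lowerColumn z i) * l + C (upperColumn z i) * m) ∈ minorIdeal f z
  independent : ∀ c c' : k, C c * l + C c' * m ∈ minorIdeal f z → c = 0 ∧ c' = 0
  eq_zero : ∀ p ∈ minorIdeal f z, p.totalDegree ≤ 1 → p = 0
  exists_degree : ∃ e, ∀ j, (φ j).IsHomogeneous e
  exists_ne_zero : ∃ j, φ j ≠ 0
  mem_iff : ∀ p, p ∈ minorIdeal f z ↔ aeval (fun j => (X (Sum.inl ()) * rename Sum.inr (φ j) :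
    MvPolynomial (Unit ⊕ Fin (N + 1)) k)) p = 0

variable {f : Fin (d + 1) → MvPolynomial (Fin (n + 1)) k} {z : Fin d → k}
  {l m : MvPolynomial (Fin (n + 1)) k} {φ : Fin (n + 1) → MvPolynomial (Fin (N + 1)) k}

/-- An identity in the free scaling parameters and variables may be specialised to any algebra. -/
theorem aeval_param_eq_zero {σ ι τ : Type*} {b : σ → ι} {ψ : σ → MvPolynomial τ k}
    {p : MvPolynomial σ k} (hp : aeval (fun s => (X (Sum.inl (b s)) * rename Sum.inr (ψ s) :
      MvPolynomial (ι ⊕ τ) k)) p = 0) {S : Type*} [CommRing S] [Algebra k S] (T : ι → S)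
    (g : MvPolynomial τ k →ₐ[k] S) : aeval (fun s => T (b s) * g (ψ s)) p = 0 := by
  have h := congrArg (aeval (Sum.elim T fun j => g (X j))) hp
  rw [map_zero, comp_aeval_apply] at h
  rw [← h]
  congr 2
  ext s : 1
  rw [map_mul, aeval_X, aeval_rename, Sum.elim_comp_inr, Sum.elim_inl]
  congr 1
  conv_lhs => rw [← aeval_X_left_apply (ψ s), comp_aeval_apply]

namespace IsColumnParametrization

theorem aeval_eq_zero (h : IsColumnParametrization f z l m φ) {p : MvPolynomial (Fin (n + 1)) k}
    (hp : p ∈ minorIdeal f z) {S : Type*} [CommRing S] [Algebra k S]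
    (g : MvPolynomial (Fin (N + 1)) k →ₐ[k] S) (T : S) : aeval (fun j => T * g (φ j)) p = 0 :=
  aeval_param_eq_zero (b := fun _ => ()) ((h.mem_iff p).mp hp) (fun _ => T) g

theorem aeval_quadric {p : MvPolynomial (Fin (n + 1)) k} (hp : p.IsHomogeneous 2)
    {S : Type*} [CommRing S] [Algebra k S]
    (g : MvPolynomial (Fin (N + 1)) k →ₐ[k] S) (T : S) :
    aeval (fun j => T * g (φ j)) p = T ^ 2 * g (aeval φ p) := by
  rw [aeval_mul_of_isHomogeneous hp, comp_aeval_apply]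

theorem aeval_column (h : IsColumnParametrization f z l m φ) {S : Type*} [CommRing S] [Algebra k S]
    (g : MvPolynomial (Fin (N + 1)) k →ₐ[k] S) (T : S) (i : Fin (d + 1)) :
    aeval (fun j => T * g (φ j)) (f i) =
      algebraMap k S (lowerColumn z i) * (T ^ 2 * g (aeval φ l)) +
        algebraMap k S (upperColumn z i) * (T ^ 2 * g (aeval φ m)) := by
  have h1 := h.aeval_eq_zero (h.column i) g T
  rw [map_sub, sub_eq_zero] at h1
  rw [h1, map_add, map_mul, map_mul, aeval_quadric h.isHomogeneous_l,
    aeval_quadric h.isHomogeneous_m]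
  simp

theorem independent_aeval (h : IsColumnParametrization f z l m φ) (c c' : k)
    (hc : C c * aeval φ l + C c' * aeval φ m = 0) : c = 0 ∧ c' = 0 := by
  refine h.independent c c' ((h.mem_iff _).mpr ?_)
  rw [aeval_quadric (g := rename Sum.inr)
    ((h.isHomogeneous_l.C_mul c).add (h.isHomogeneous_m.C_mul c'))]
  simp only [map_add, map_mul, aeval_C, MvPolynomial.algebraMap_eq]
  rw [← map_mul, ← map_mul, ← map_add, hc]
  simp

theorem l_ne_zero (h : IsColumnParametrization f z l m φ) : aeval φ l ≠ 0 :=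
  fun h0 => one_ne_zero (h.independent_aeval 1 0 (by rw [h0]; simp)).1

theorem m_ne_zero (h : IsColumnParametrization f z l m φ) : aeval φ m ≠ 0 :=
  fun h0 => one_ne_zero (h.independent_aeval 0 1 (by rw [h0]; simp)).2

/-- Pseudo-division by `μ x_0 - λ x_1` as a polynomial in `x_0` with leading coefficient `μ`: the
remainder `q` is a polynomial in `x_1` over `k[y]`. -/
theorem exists_mul_sub_mem (l m : MvPolynomial (Fin (n + 1)) k)
    (p : MvPolynomial (Fin 2 ⊕ Fin (n + 1)) k) :
    ∃ (a : ℕ) (q : Polynomial (MvPolynomial (Fin (n + 1)) k)),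
      rename Sum.inr m ^ a * p -
        q.eval₂ (rename (R := k) (Sum.inr : Fin (n + 1) → Fin 2 ⊕ Fin (n + 1))).toRingHom
          (X (Sum.inl 1)) ∈
        Ideal.span {rename Sum.inr m * X (Sum.inl 0) - rename Sum.inr l * X (Sum.inl 1)} := by
  set r := (rename (R := k) (Sum.inr : Fin (n + 1) → Fin 2 ⊕ Fin (n + 1))).toRingHom with hr
  have hr' : ∀ p, rename (R := k) (Sum.inr : Fin (n + 1) → Fin 2 ⊕ Fin (n + 1)) p = r p :=
    fun _ => rfl
  simp only [hr']
  set J := Ideal.span {r m * X (Sum.inl 0) - r l * X (Sum.inl 1)} with hJ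
  have hLJ : r m * X (Sum.inl 0) - r l * X (Sum.inl 1) ∈ J := Ideal.mem_span_singleton_self _
  induction p using MvPolynomial.induction_on with
  | C c =>
    refine ⟨0, Polynomial.C (C c), ?_⟩
    have : r (C c) = C c := rename_C _ _
    rw [Polynomial.eval₂_C, this]
    simp
  | add p p' hp hp' =>
    obtain ⟨a, q, hq⟩ := hp
    obtain ⟨a', q', hq'⟩ := hp'
    refine ⟨a + a', Polynomial.C (m ^ a') * q + Polynomial.C (m ^ a) * q', ?_⟩
    have := J.add_mem (J.mul_mem_left (r m ^ a') hq) (J.mul_mem_left (r m ^ a) hq')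
    convert this using 1
    simp only [Polynomial.eval₂_add, Polynomial.eval₂_mul, Polynomial.eval₂_pow, Polynomial.eval₂_C,
      map_pow]
    ring
  | mul_X p s hp =>
    obtain ⟨a, q, hq⟩ := hp
    rcases s with s | j
    · fin_cases s
      · refine ⟨a + 1, q * Polynomial.C l * Polynomial.X, ?_⟩
        have := J.add_mem (J.mul_mem_left (r l * X (Sum.inl 1)) hq)
          (J.mul_mem_left (r m ^ a * p) hLJ)
        convert this using 1
        simp only [Polynomial.eval₂_mul, Polynomial.eval₂_C, Polynomial.eval₂_X, Fin.zero_eta]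
        ring
      · refine ⟨a, q * Polynomial.X, ?_⟩
        have := J.mul_mem_left (X (Sum.inl 1)) hq
        convert this using 1
        simp only [Polynomial.eval₂_mul, Polynomial.eval₂_X, Fin.mk_one]
        ring
    · refine ⟨a, q * Polynomial.C (X j), ?_⟩
      have := J.mul_mem_left (X (Sum.inr j)) hq
      convert this using 1
      have hX : r (X j) = X (Sum.inr j) := rename_X _ _
      simp only [Polynomial.eval₂_mul, Polynomial.eval₂_C, hX]
      ring

/-- The coordinates of the rational map to `ℙ^1 × ℙ^n` whose image is dense in the strict
transform. -/
noncomputable def strictCoord (l m : MvPolynomial (Fin (n + 1)) k)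
    (φ : Fin (n + 1) → MvPolynomial (Fin (N + 1)) k) :
    Fin 2 ⊕ Fin (n + 1) → MvPolynomial (Fin (N + 1)) k :=
  Sum.elim ![aeval φ l, aeval φ m] φ

/-- The pseudo-remainder `q` also vanishes under the parametrisation, where `x_1` becomes `T μ(φ)`
with `T` free. Comparing powers of `T` and cancelling powers of `μ(φ) ≠ 0` shows that every
coefficient of `q` vanishes on `X_z`. -/
theorem exists_pow_mul_mem (h : IsColumnParametrization f z l m φ)
    {p : MvPolynomial (Fin 2 ⊕ Fin (n + 1)) k}
    (hp : aeval (fun s => (X (Sum.inl (biprojBlock n s)) * rename Sum.inr (strictCoord l m φ s) :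
      MvPolynomial (Fin 2 ⊕ Fin (N + 1)) k)) p = 0) :
    ∃ a : ℕ, rename Sum.inr m ^ a * p ∈ (minorIdeal f z).map (rename Sum.inr :
      MvPolynomial (Fin (n + 1)) k →ₐ[k] MvPolynomial (Fin 2 ⊕ Fin (n + 1)) k) ⊔
        Ideal.span {rename Sum.inr m * X (Sum.inl 0) - rename Sum.inr l * X (Sum.inl 1)} := by
  obtain ⟨a, q, hq⟩ := exists_mul_sub_mem l m p
  refine ⟨a, ?_⟩
  rw [← sub_add_cancel (rename Sum.inr m ^ a * p)]
  refine Ideal.add_mem _ (Ideal.mem_sup_right hq) (Ideal.mem_sup_left ?_)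
  rw [Polynomial.eval₂_eq_sum_range]
  refine Ideal.sum_mem _ fun i _ => Ideal.mul_mem_right _ _
    (Ideal.mem_map_of_mem (rename (R := k) (Sum.inr : Fin (n + 1) → Fin 2 ⊕ Fin (n + 1))) ?_)
  rw [h.mem_iff]
  let W := MvPolynomial (Unit ⊕ Fin (N + 1)) k
  let g : MvPolynomial (Fin (N + 1)) k →ₐ[k] Polynomial W :=
    Polynomial.CAlgHom.comp (rename Sum.inr)
  let T : Fin 2 → Polynomial W := ![Polynomial.X, Polynomial.C (X (Sum.inl ()))]
  let v : Fin 2 ⊕ Fin (n + 1) → Polynomial W :=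
    fun s => T (biprojBlock n s) * g (strictCoord l m φ s)
  let w : Fin (n + 1) → W := fun j => X (Sum.inl ()) * rename Sum.inr (φ j)
  have hpv : aeval v p = 0 := aeval_param_eq_zero hp T g
  have hv : ∀ p : MvPolynomial (Fin (n + 1)) k, aeval v (rename Sum.inr p) = Polynomial.C (aeval w p) := by
    intro p
    rw [aeval_rename]
    have : (Polynomial.CAlgHom : W →ₐ[k] Polynomial W) (aeval w p) = Polynomial.C (aeval w p) := rfl
    rw [← this, comp_aeval_apply]
    congr 2
    ext j : 1
    exact (Polynomial.C_mul).symm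
  have hv0 : v (Sum.inl 0) = Polynomial.X * g (aeval φ l) := rfl
  have hv1 : v (Sum.inl 1) = Polynomial.C (rename Sum.inr (aeval φ m)) * Polynomial.X :=
    mul_comm Polynomial.X (Polynomial.C (rename Sum.inr (aeval φ m)))
  have hvL : aeval v (rename Sum.inr m * X (Sum.inl 0) - rename Sum.inr l * X (Sum.inl 1)) = 0 := by
    rw [map_sub, map_mul, map_mul, hv, hv, aeval_X, aeval_X, hv0, hv1,
      aeval_quadric (g := rename Sum.inr) h.isHomogeneous_l,
      aeval_quadric (g := rename Sum.inr) h.isHomogeneous_m]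
    simp only [g, AlgHom.comp_apply, Polynomial.CAlgHom_apply, Polynomial.C_mul]
    ring
  have hq0 : aeval v (q.eval₂ (rename (R := k)
      (Sum.inr : Fin (n + 1) → Fin 2 ⊕ Fin (n + 1))).toRingHom (X (Sum.inl 1))) = 0 := by
    obtain ⟨r, hr⟩ := Ideal.mem_span_singleton'.mp hq
    have := congrArg (aeval v) hr
    rw [map_mul, hvL, mul_zero, map_sub, map_mul, hpv, mul_zero, zero_sub, eq_comm,
      neg_eq_zero] at this
    exact this
  have hcomp : (q.map (aeval w : MvPolynomial (Fin (n + 1)) k →ₐ[k] W).toRingHom).comp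
      (Polynomial.C (rename Sum.inr (aeval φ m)) * Polynomial.X) = 0 := by
    refine Eq.trans ?_ ((Polynomial.hom_eval₂ q _ (aeval (R := k) v).toRingHom _).symm.trans hq0)
    have hx : (aeval (R := k) v).toRingHom (X (Sum.inl 1)) =
        Polynomial.C (rename Sum.inr (aeval φ m)) * Polynomial.X := (aeval_X v _).trans hv1
    rw [hx, Polynomial.comp, Polynomial.eval₂_map]
    congr 1
    exact RingHom.ext fun x => (hv x).symm
  have hi := congrArg (fun P => Polynomial.coeff P i) hcomp
  simp only [Polynomial.comp_C_mul_X_coeff, Polynomial.coeff_map, Polynomial.coeff_zero] at hi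
  refine (mul_eq_zero.mp hi).resolve_right (pow_ne_zero _ ?_)
  rw [Ne, map_eq_zero_iff _ (rename_injective _ Sum.inr_injective)]
  exact h.m_ne_zero

theorem minorIdeal_map_le (f : Fin (d + 1) → MvPolynomial (Fin (n + 1)) k) (z : Fin d → k) :
    (minorIdeal f z).map (rename Sum.inr :
      MvPolynomial (Fin (n + 1)) k →ₐ[k] MvPolynomial (Fin 2 ⊕ Fin (n + 1)) k) ≤
      preimageIdeal f z := le_sup_right

/-- The evaluation of the forms modulo the equations of `X_z`. -/
theorem mk_column (h : IsColumnParametrization f z l m φ) (i : Fin (d + 1)) :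
    aeval (fun j => Ideal.Quotient.mk ((minorIdeal f z).map (rename Sum.inr :
      MvPolynomial (Fin (n + 1)) k →ₐ[k] MvPolynomial (Fin 2 ⊕ Fin (n + 1)) k))
        (X (Sum.inr j))) (f i) =
      algebraMap k _ (lowerColumn z i) * Ideal.Quotient.mk _ (rename Sum.inr l) +
        algebraMap k _ (upperColumn z i) * Ideal.Quotient.mk _ (rename Sum.inr m) := by
  set I := (minorIdeal f z).map (rename Sum.inr :
      MvPolynomial (Fin (n + 1)) k →ₐ[k] MvPolynomial (Fin 2 ⊕ Fin (n + 1)) k)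
  have h1 : ∀ p : MvPolynomial (Fin (n + 1)) k,
      aeval (fun j => Ideal.Quotient.mk I (X (Sum.inr j))) p =
        Ideal.Quotient.mkₐ k I (rename Sum.inr p) := by
    intro p
    rw [rename_eq_aeval, comp_aeval_apply]
    rfl
  have h2 : Ideal.Quotient.mkₐ k I (rename Sum.inr (f i -
      (C (lowerColumn z i) * l + C (upperColumn z i) * m))) = 0 :=
    Ideal.Quotient.eq_zero_iff_mem.mpr (Ideal.mem_map_of_mem _ (h.column i))
  rw [map_sub, map_sub, sub_eq_zero] at h2
  rw [h1, h2]
  simp only [map_add, map_mul, rename_C]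
  rfl

/-- `mul_rho_mem` in the quotient by the equations of `X_z`, where the column relations hold
exactly. -/
theorem mul_rhoForm_mem (h : IsColumnParametrization f z l m φ) (i : Fin d) :
    (rename Sum.inr m * X (Sum.inl 0) - rename Sum.inr l * X (Sum.inl 1)) * rhoForm f i ∈
      preimageIdeal f z := by
  obtain ⟨t, ht, hmin⟩ := exists_min_ne_zero h.ne_zero
  set I := (minorIdeal f z).map (rename Sum.inr :
      MvPolynomial (Fin (n + 1)) k →ₐ[k] MvPolynomial (Fin 2 ⊕ Fin (n + 1)) k) with hI
  set π := Ideal.Quotient.mkₐ k I with hπ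
  have hev : ∀ p, aeval (fun s => π (X s)) p = π p := by
    intro p
    conv_rhs => rw [← aeval_X_left_apply p, comp_aeval_apply]
  have hcol := h.mk_column
  have hρ := fun i => aeval_rhoForm_of_columns (v := fun s => π (X s)) hcol i
  have hD := aeval_divisorForm_of_columns (v := fun s => π (X s)) hcol
  rw [hev] at hD
  simp only [hev] at hρ
  have hle := minorIdeal_map_le f z
  have hmem : ∀ p, p ∈ preimageIdeal f z → π p ∈ (preimageIdeal f z).map π :=
    fun p hp => Ideal.mem_map_of_mem π hp
  refine (Ideal.mem_quotient_iff_mem hle).mp ?_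
  have key := mul_rho_mem (ρ := fun i => π (rhoForm f i)) hρ (t := t)
    (((isUnit_iff_ne_zero.mpr ht)).map (algebraMap k _))
    (fun j hj => by rw [hmin j hj, map_zero]) (P := (preimageIdeal f z).map π)
    (by
      rw [← hD]
      exact hmem _ (Ideal.mem_sup_left (Ideal.mem_sup_left (Ideal.mem_span_singleton_self _))))
    (fun i j => by
      have : C (z i) * rhoForm f j - C (z j) * rhoForm f i ∈ preimageIdeal f z :=
        Ideal.mem_sup_left (Ideal.mem_sup_right (Ideal.subset_span ⟨i, j, rfl⟩))
      exact hmem _ this) i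
  exact key

theorem strictCoord_scaled (l m : MvPolynomial (Fin (n + 1)) k)
    (φ : Fin (n + 1) → MvPolynomial (Fin (N + 1)) k) :
    (fun s => (X (Sum.inl (biprojBlock n s)) * rename Sum.inr (strictCoord l m φ s) :
      MvPolynomial (Fin 2 ⊕ Fin (N + 1)) k)) =
      Sum.elim ![X (Sum.inl 0) * rename Sum.inr (aeval φ l),
        X (Sum.inl 0) * rename Sum.inr (aeval φ m)]
        fun j => X (Sum.inl 1) * rename Sum.inr (φ j) := by
  ext1 s
  rcases s with s | j
  · fin_cases s <;> rfl
  · rfl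

/-- The kernel is prime. It contains the equations of the preimage because `μ x_0 - λ x_1` vanishes
on the graph, and it misses some `ρ_i` because there `ρ_i = μ x_1^{d-1} z_i`. -/
theorem strictTransformIdeal_le (h : IsColumnParametrization f z l m φ) :
    strictTransformIdeal f z ≤ RingHom.ker (aeval (R := k) (fun s =>
      (X (Sum.inl (biprojBlock n s)) * rename Sum.inr (strictCoord l m φ s) :
        MvPolynomial (Fin 2 ⊕ Fin (N + 1)) k))).toRingHom := by
  rw [strictCoord_scaled]
  set v : Fin 2 ⊕ Fin (n + 1) → MvPolynomial (Fin 2 ⊕ Fin (N + 1)) k :=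
    Sum.elim ![X (Sum.inl 0) * rename Sum.inr (aeval φ l),
        X (Sum.inl 0) * rename Sum.inr (aeval φ m)]
        fun j => X (Sum.inl 1) * rename Sum.inr (φ j) with hv
  set Φ := aeval (R := k) v with hΦ
  have hcol : ∀ i, aeval (fun j => v (Sum.inr j)) (f i) = _ :=
    h.aeval_column (rename Sum.inr) (X (Sum.inl 1))
  have hL : (X (Sum.inl 1) ^ 2 * rename Sum.inr (aeval φ m)) * v (Sum.inl 0) -
      (X (Sum.inl 1) ^ 2 * rename Sum.inr (aeval φ l)) * v (Sum.inl 1) = 0 := by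
    simp only [hv, Sum.elim_inl, Matrix.cons_val_zero, Matrix.cons_val_one]
    ring
  have hD : Φ (divisorForm f) = 0 := by
    rw [hΦ, aeval_divisorForm_of_columns hcol, hL, zero_mul]
  have hρ : ∀ i, Φ (rhoForm f i) = (X (Sum.inl 1) ^ 2 * rename Sum.inr (aeval φ m)) *
      v (Sum.inl 1) ^ (d - 1) * C (z i) := by
    intro i
    rw [hΦ, aeval_rhoForm_of_columns hcol, hL, zero_mul, add_zero, MvPolynomial.algebraMap_eq]
  have hP : preimageIdeal f z ≤ RingHom.ker Φ.toRingHom := by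
    refine sup_le (sup_le ?_ ?_) ?_
    · rw [Ideal.span_singleton_le_iff_mem]
      exact hD
    · rw [Ideal.span_le]
      rintro _ ⟨i, j, rfl⟩
      change Φ _ = 0
      rw [map_sub, map_mul, map_mul, hρ, hρ]
      simp only [hΦ, aeval_C, MvPolynomial.algebraMap_eq]
      ring
    · rw [Ideal.map_le_iff_le_comap]
      intro p hp
      change Φ (rename Sum.inr p) = 0
      rw [hΦ, aeval_rename]
      exact h.aeval_eq_zero hp (rename Sum.inr) (X (Sum.inl 1))
  have hnot : ¬ Ideal.span (Set.range (rhoForm f)) ≤ RingHom.ker Φ.toRingHom := by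
    intro hle
    obtain ⟨t, ht, -⟩ := exists_min_ne_zero h.ne_zero
    have h0 : Φ (rhoForm f t) = 0 := hle (Ideal.subset_span ⟨t, rfl⟩)
    have hm : rename Sum.inr (aeval φ m) ≠ (0 : MvPolynomial (Fin 2 ⊕ Fin (N + 1)) k) := by
      rw [Ne, map_eq_zero_iff _ (rename_injective _ Sum.inr_injective)]
      exact h.m_ne_zero
    have hv1 : v (Sum.inl 1) ≠ 0 := mul_ne_zero (X_ne_zero _) hm
    rw [hρ] at h0
    exact mul_ne_zero (mul_ne_zero (mul_ne_zero (pow_ne_zero _ (X_ne_zero _)) hm)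
      (pow_ne_zero _ hv1)) ((C_ne_zero).mpr ht) h0
  exact saturationAlong_le (RingHom.ker_isPrime Φ.toRingHom) hP hnot

/-- The strict transform is the closure of the image of the rational map `strictCoord`. -/
theorem mem_strictTransformIdeal (h : IsColumnParametrization f z l m φ)
    (p : MvPolynomial (Fin 2 ⊕ Fin (n + 1)) k) :
    p ∈ strictTransformIdeal f z ↔
      aeval (fun s => (X (Sum.inl (biprojBlock n s)) * rename Sum.inr (strictCoord l m φ s) :
        MvPolynomial (Fin 2 ⊕ Fin (N + 1)) k)) p = 0 := by
  refine ⟨fun hp => h.strictTransformIdeal_le hp, fun hp => ?_⟩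
  obtain ⟨a, ha⟩ := h.exists_pow_mul_mem hp
  set I := (minorIdeal f z).map (rename Sum.inr :
    MvPolynomial (Fin (n + 1)) k →ₐ[k] MvPolynomial (Fin 2 ⊕ Fin (n + 1)) k) with hI
  set L : MvPolynomial (Fin 2 ⊕ Fin (n + 1)) k :=
    rename Sum.inr m * X (Sum.inl 0) - rename Sum.inr l * X (Sum.inl 1) with hL
  -- Modulo `I` and `L`, `ρ_i` is a multiple of `μ`, so `ρ_i ^ a` plays the role of `μ ^ a`; the
  -- extra factor `ρ_i` moves `L` into the ideal of the preimage.
  refine mem_saturationAlong_span fun i => ⟨a + 1, ?_⟩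
  have hρ : rhoForm f i - rename Sum.inr m * X (Sum.inl 1) ^ (d - 1) * C (z i) ∈
      I ⊔ Ideal.span {L} := by
    have h1 := aeval_rhoForm_of_columns
      (v := fun s => Ideal.Quotient.mkₐ k I (X s)) h.mk_column i
    have hev : ∀ p, aeval (fun s => Ideal.Quotient.mkₐ k I (X s)) p =
        Ideal.Quotient.mkₐ k I p := by
      intro p
      conv_rhs => rw [← aeval_X_left_apply p, comp_aeval_apply]
    rw [hev] at h1
    refine (Ideal.mem_quotient_iff_mem (le_sup_left : I ≤ _)).mp ?_
    have hLmem : Ideal.Quotient.mk I L ∈ (I ⊔ Ideal.span {L}).map (Ideal.Quotient.mk I) :=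
      Ideal.mem_map_of_mem _ (Ideal.mem_sup_right (Ideal.mem_span_singleton_self _))
    have h2 : Ideal.Quotient.mk I (rhoForm f i -
        rename Sum.inr m * X (Sum.inl 1) ^ (d - 1) * C (z i)) = Ideal.Quotient.mk I L * _ :=
      sub_eq_of_eq_add' h1
    rw [h2]
    exact Ideal.mul_mem_right _ _ hLmem
  have hpow : p * rhoForm f i ^ a ∈ I ⊔ Ideal.span {L} := by
    have h1 := Ideal.mul_mem_left _ p (Ideal.mem_of_dvd _ (sub_dvd_pow_sub_pow _ _ a) hρ)
    have h2 := Ideal.mul_mem_left _ ((X (Sum.inl 1) ^ (d - 1) * C (z i)) ^ a) ha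
    have h3 := Ideal.add_mem _ h1 h2
    convert h3 using 1
    ring
  have hle : I ⊔ Ideal.span {L} ≤ Submodule.colon (preimageIdeal f z) {rhoForm f i} := by
    refine sup_le (fun q hq => Submodule.mem_colon_singleton.mpr ?_) ?_
    · exact Ideal.mul_mem_right _ _ (minorIdeal_map_le f z hq)
    · rw [Ideal.span_singleton_le_iff_mem, Submodule.mem_colon_singleton]
      exact h.mul_rhoForm_mem i
  have := Submodule.mem_colon_singleton.mp (hle hpow)
  rwa [smul_eq_mul, mul_assoc, ← pow_succ] at this

end IsColumnParametrization

end StrictTransform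

/-! ### Unirationality of the strict transform and dominance over the line -/

section StrictTransform

variable {k : Type*} [Field k] {n d N : ℕ} {f : Fin (d + 1) → MvPolynomial (Fin (n + 1)) k}
  {z : Fin d → k} {l m : MvPolynomial (Fin (n + 1)) k}
  {φ : Fin (n + 1) → MvPolynomial (Fin (N + 1)) k}

namespace IsColumnParametrization

theorem transcendental (h : IsColumnParametrization f z l m φ) :
    Transcendental k (algebraMap (MvPolynomial (Fin (N + 1)) k)
      (FractionRing (MvPolynomial (Fin (N + 1)) k)) (aeval φ l) /
        algebraMap (MvPolynomial (Fin (N + 1)) k) _ (aeval φ m)) :=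
  transcendental_div h.independent_aeval

theorem binary_eq_zero (h : IsColumnParametrization f z l m φ) {G : MvPolynomial (Fin 2) k}
    (hG : aeval ![Polynomial.X * Polynomial.C (aeval φ l), Polynomial.X * Polynomial.C (aeval φ m)]
      G = 0) : G = 0 :=
  eq_zero_of_aeval_binary h.m_ne_zero h.transcendental hG

theorem strictTransform_unirational (h : IsColumnParametrization f z l m φ) :
    schemeIdeal (biprojBlock n) (strictTransformIdeal f z) = strictTransformIdeal f z ∧
      IsUnirational (biprojBlock n) (strictTransformIdeal f z) := by
  obtain ⟨e, he⟩ := h.exists_degree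
  obtain ⟨j, hj⟩ := h.exists_ne_zero
  refine isUnirational_of_parametrization (φ := strictCoord l m φ) (fun i => ?_)
    h.mem_strictTransformIdeal
  fin_cases i
  · refine ⟨⟨e * 2, ?_⟩, Sum.inl 0, rfl, h.l_ne_zero⟩
    rintro (s | j) hs
    · fin_cases s
      · exact h.isHomogeneous_l.aeval _ he
      · exact h.isHomogeneous_m.aeval _ he
    · exact absurd hs (by simp [biprojBlock])
  · refine ⟨⟨e, ?_⟩, Sum.inr j, rfl, hj⟩
    rintro (s | j) hs
    · exact absurd hs (by simp [biprojBlock])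
    · exact he j

theorem strictTransform_dominatesLine (h : IsColumnParametrization f z l m φ) :
    DominatesLine (strictTransformIdeal f z) := by
  rw [DominatesLine, h.strictTransform_unirational.1, eq_bot_iff]
  intro G hG
  rw [Ideal.mem_comap, h.mem_strictTransformIdeal] at hG
  -- Both scaling parameters become one variable `T`, so that `G` vanishes at `(λ(φ) T, μ(φ) T)`, an
  -- algebraically independent pair.
  have h1 := aeval_param_eq_zero hG (fun _ => Polynomial.X) Polynomial.CAlgHom
  rw [aeval_rename] at h1
  refine h.binary_eq_zero (Eq.trans (congrArg (fun v => aeval v G) (funext fun i => ?_)) h1)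
  fin_cases i <;> rfl

end IsColumnParametrization

end StrictTransform

/-! ### Gram matrices -/

section Gram

variable {k σ : Type*} [Field k] [Fintype σ]

/-- A quadratic form in characteristic different from two has a symmetric Gram matrix. -/
theorem exists_gram (h2 : (2 : k) ≠ 0) {f : MvPolynomial σ k} (hf : f.IsHomogeneous 2) :
    ∃ G : Matrix σ σ k, G.transpose = G ∧ f = ∑ i, ∑ j, C (G i j) * (X i * X j) := by
  classical
  have key : ∃ G : Matrix σ σ k, f = ∑ i, ∑ j, C (G i j) * (X i * X j) := by
    have hmem : f ∈ homogeneousSubmodule σ k 2 := hf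
    rw [← homogeneousSubmodule_one_pow, homogeneousSubmodule_one_eq_span_X, pow_two,
      Submodule.span_mul_span] at hmem
    clear hf
    induction hmem using Submodule.span_induction with
    | mem x hx =>
      obtain ⟨_, ⟨i, rfl⟩, _, ⟨j, rfl⟩, rfl⟩ := hx
      refine ⟨Matrix.single i j 1, ?_⟩
      rw [Finset.sum_eq_single i, Finset.sum_eq_single j]
      · simp
      · intro b _ hb
        simp [hb.symm]
      · simp
      · intro b _ hb
        refine Finset.sum_eq_zero fun c _ => ?_
        simp [hb.symm]
      · simp
    | zero => exact ⟨0, by simp⟩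
    | add x y _ _ hx hy =>
      obtain ⟨G, hG⟩ := hx
      obtain ⟨H, hH⟩ := hy
      refine ⟨G + H, ?_⟩
      simp only [Matrix.add_apply, C_add, add_mul, Finset.sum_add_distrib]
      rw [← hG, ← hH]
    | smul a x _ hx =>
      obtain ⟨G, hG⟩ := hx
      refine ⟨a • G, ?_⟩
      conv_lhs => rw [hG]
      simp only [Matrix.smul_apply, smul_eq_mul, C_mul, MvPolynomial.smul_eq_C_mul, Finset.mul_sum,
        mul_assoc]
  obtain ⟨G, hG⟩ := key
  refine ⟨(2 : k)⁻¹ • (G + G.transpose), ?_, ?_⟩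
  · rw [Matrix.transpose_smul, Matrix.transpose_add, Matrix.transpose_transpose, add_comm]
  · have hG' : f = ∑ i, ∑ j, C (G j i) * (X i * X j) := by
      rw [Finset.sum_comm]
      refine hG.trans (Finset.sum_congr rfl fun i _ => Finset.sum_congr rfl fun j _ => ?_)
      rw [mul_comm (X i)]
    have h22 : (C (2 : k)⁻¹ : MvPolynomial σ k) * C 2 = 1 := by
      rw [← C_mul, inv_mul_cancel₀ h2, C_1]
    have h2f : C 2 * f = f + f := by
      rw [show (C (2 : k) : MvPolynomial σ k) = 2 from rfl]
      ring
    calc f = C (2 : k)⁻¹ * (C 2 * f) := by rw [← mul_assoc, h22, one_mul]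
      _ = C (2 : k)⁻¹ * ((∑ i, ∑ j, C (G i j) * (X i * X j)) +
            ∑ i, ∑ j, C (G j i) * (X i * X j)) := by rw [h2f, ← hG, ← hG']
      _ = _ := by
        simp only [Matrix.smul_apply, Matrix.add_apply, Matrix.transpose_apply, smul_eq_mul, C_mul,
          C_add, mul_add, add_mul, Finset.sum_add_distrib, Finset.mul_sum, mul_assoc]

end Gram

/-! ### Kernels of a pencil of symmetric matrices -/

section Connection

open Polynomial in
/-- If a vector is in the kernel of a symmetric matrix over `k[u]`, with `u` transcendental, then it
is isotropic for the derivative of the matrix. -/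
theorem sum_derivative_eq_zero {k E ι : Type*} [Field k] [Field E] [Algebra k E] [Fintype ι] {u : E}
    (hu : Transcendental k u) {M : Matrix ι ι k[X]} (hM : M.transpose = M) {φ : ι → E}
    (h : ∀ i, ∑ j, Polynomial.aeval u (M i j) * φ j = 0) :
    ∑ i, ∑ j, φ i * (Polynomial.aeval u (derivative (M i j)) * φ j) = 0 := by
  classical
  let _ : Algebra k[X] E := (Polynomial.aeval u).toAlgebra
  -- In positive characteristic `u` may be a `p`-th power in `E`, so `d/du` need not extend to `E`.
  -- Instead `φ` is expanded in a basis of its `k[u]`-span, which is free as a finitely generated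
  -- torsion-free module over a principal ideal domain.
  have hsmul : ∀ (p : k[X]) (e : E), p • e = Polynomial.aeval u p * e := fun p e =>
    Algebra.smul_def p e
  have hinj : Function.Injective (algebraMap k[X] E) := transcendental_iff_injective.mp hu
  have : FaithfulSMul k[X] E := (faithfulSMul_iff_algebraMap_injective _ _).mpr hinj
  have : Module.IsTorsionFree k[X] E := inferInstance
  let V : Submodule k[X] E := Submodule.span k[X] (Set.range φ)
  have : Module.Finite k[X] V := Module.Finite.span_of_finite _ (Set.finite_range φ)
  have : Module.Free k[X] V := Module.free_of_finite_type_torsion_free'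
  let e := Module.Free.chooseBasis k[X] V
  let φ' : ι → V := fun j => ⟨φ j, Submodule.subset_span ⟨j, rfl⟩⟩
  let c : ι → Module.Free.ChooseBasisIndex k[X] V → k[X] := fun j t => e.repr (φ' j) t
  have hφ : ∀ j, φ j = ∑ t, Polynomial.aeval u (c j t) * (e t : E) := by
    intro j
    have := congrArg (Subtype.val) (e.sum_repr (φ' j))
    rw [← show (φ' j : E) = φ j from rfl, ← this]
    simp only [AddSubmonoidClass.coe_finsetSum, Submodule.coe_smul, hsmul]
    rfl
  have hc : ∀ i t, ∑ j, M i j * c j t = 0 := by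
    intro i t
    have h1 : ∑ j, M i j • φ' j = 0 := by
      apply Subtype.ext
      simp only [AddSubmonoidClass.coe_finsetSum, Submodule.coe_smul, hsmul]
      exact h i
    have h2 := DFunLike.congr_fun (congrArg e.repr h1) t
    simpa [map_sum, Finsupp.finsetSum_apply] using h2
  -- The derivative of `φ` with the basis held constant. Differentiating `M c = 0` gives `M' φ + M δ
  -- = 0`, and pairing with `φ` kills `M δ` by symmetry.
  let δ : ι → E := fun j => ∑ t, Polynomial.aeval u (derivative (c j t)) * (e t : E)
  have hδ : ∀ i, ∑ j, Polynomial.aeval u (derivative (M i j)) * φ j +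
      ∑ j, Polynomial.aeval u (M i j) * δ j = 0 := by
    intro i
    have h1 : ∀ t, (∑ j, Polynomial.aeval u (derivative (M i j)) * Polynomial.aeval u (c j t) +
        ∑ j, Polynomial.aeval u (M i j) * Polynomial.aeval u (derivative (c j t))) = 0 := by
      intro t
      have := congrArg (fun p => Polynomial.aeval u (derivative p)) (hc i t)
      simpa [derivative_sum, derivative_mul, Finset.sum_add_distrib] using this
    calc _ = ∑ t, (∑ j, Polynomial.aeval u (derivative (M i j)) * Polynomial.aeval u (c j t) +
        ∑ j, Polynomial.aeval u (M i j) * Polynomial.aeval u (derivative (c j t))) * (e t : E) := by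
          simp only [hφ, δ, Finset.mul_sum, Finset.sum_mul, add_mul, Finset.sum_add_distrib]
          rw [Finset.sum_comm]
          congr 1
          · simp only [mul_assoc]
          · rw [Finset.sum_comm]
            simp only [mul_assoc]
      _ = 0 := by simp [h1]
  have hM' : ∀ i j, M i j = M j i := fun i j => congrFun (congrFun hM.symm i) j
  calc ∑ i, ∑ j, φ i * (Polynomial.aeval u (derivative (M i j)) * φ j)
      = ∑ i, φ i * (-∑ j, Polynomial.aeval u (M i j) * δ j) := by
        refine Finset.sum_congr rfl fun i _ => ?_
        rw [← Finset.mul_sum, eq_neg_of_add_eq_zero_left (hδ i)]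
    _ = -∑ j, (∑ i, Polynomial.aeval u (M j i) * φ i) * δ j := by
        simp only [mul_neg, Finset.mul_sum, Finset.sum_mul, Finset.sum_neg_distrib]
        rw [Finset.sum_comm]
        congr 1
        refine Finset.sum_congr rfl fun j _ => Finset.sum_congr rfl fun i _ => ?_
        rw [hM' i j]
        ring
    _ = 0 := by simp [h]

end Connection

/-! ### The quadric bundle -/

section Bundle

variable {k : Type*} [Field k] {n d : ℕ}

/-- The matrix `∑ x^{d-t} y^t G_t`. -/
def bundleGram {S : Type*} [CommRing S] [Algebra k S] {ι : Type*} (G : Fin (d + 1) → Matrix ι ι k)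
    (x y : S) : Matrix ι ι S :=
  fun i j => ∑ t : Fin (d + 1), x ^ (d - (t : ℕ)) * y ^ (t : ℕ) * algebraMap k S (G t i j)

/-- The polynomial `∑ x^{d-t} y^t f_t` for values `x` and `y` in a `k`-algebra. -/
noncomputable def bundlePoly {S σ : Type*} [CommRing S] [Algebra k S]
    (f : Fin (d + 1) → MvPolynomial σ k) (x y : S) : MvPolynomial σ S :=
  ∑ t : Fin (d + 1), C (x ^ (d - (t : ℕ)) * y ^ (t : ℕ)) * map (algebraMap k S) (f t)

theorem bundleGram_apply {S : Type*} [CommRing S] [Algebra k S] {ι : Type*}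
    (G : Fin (d + 1) → Matrix ι ι k) (x y : S) (i j : ι) : bundleGram G x y i j =
      ∑ t : Fin (d + 1), x ^ (d - (t : ℕ)) * y ^ (t : ℕ) * algebraMap k S (G t i j) := rfl

theorem bundleGram_symm {S : Type*} [CommRing S] [Algebra k S] {ι : Type*}
    {G : Fin (d + 1) → Matrix ι ι k} (hG : ∀ t, (G t).transpose = G t) (x y : S) :
    (bundleGram G x y).transpose = bundleGram G x y := by
  ext i j
  rw [Matrix.transpose_apply, bundleGram_apply, bundleGram_apply]
  refine Finset.sum_congr rfl fun t _ => ?_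
  rw [show G t j i = G t i j from congrFun (congrFun (hG t) i) j]

theorem sum_aeval_eq_bundleGram {S : Type*} [CommRing S] [Algebra k S] {ι : Type*} [Fintype ι]
    {f : Fin (d + 1) → MvPolynomial ι k} {G : Fin (d + 1) → Matrix ι ι k}
    (hG : ∀ t, f t = ∑ i, ∑ j, C (G t i j) * (X i * X j)) (x y : S) (v : ι → S) :
    ∑ t : Fin (d + 1), x ^ (d - (t : ℕ)) * y ^ (t : ℕ) * aeval v (f t) =
      ∑ i, ∑ j, bundleGram G x y i j * (v i * v j) := by
  have h1 : ∀ t, aeval v (f t) = ∑ i, ∑ j, algebraMap k S (G t i j) * (v i * v j) := by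
    intro t
    conv_lhs => rw [hG t]
    simp
  simp only [h1, bundleGram_apply, Finset.sum_mul, Finset.mul_sum]
  rw [Finset.sum_comm]
  refine Finset.sum_congr rfl fun i _ => ?_
  rw [Finset.sum_comm]
  simp only [mul_assoc]

/-- The second intersection point of a quadric with the line through a point of the quadric and
another point. -/
theorem isotropic_residual {S ι : Type*} [CommRing S] [Fintype ι] {M : Matrix ι ι S}
    (hM : M.transpose = M) {v w : ι → S} (hv : ∑ i, ∑ j, M i j * (v i * v j) = 0) {a b : S}
    (ha : a = ∑ i, ∑ j, M i j * (w i * w j)) (hb : b = ∑ i, ∑ j, M i j * (v i * w j)) :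
    ∑ i, ∑ j, M i j * ((a * v i - 2 * b * w i) * (a * v j - 2 * b * w j)) = 0 := by
  have hb' : b = ∑ i, ∑ j, M i j * (w i * v j) := by
    rw [hb, Finset.sum_comm]
    refine Finset.sum_congr rfl fun i _ => Finset.sum_congr rfl fun j _ => ?_
    rw [show M i j = M j i from congrFun (congrFun hM.symm i) j, mul_comm (w i)]
  have h1 : ∀ i j, M i j * ((a * v i - 2 * b * w i) * (a * v j - 2 * b * w j)) =
      a ^ 2 * (M i j * (v i * v j)) - 2 * a * b * (M i j * (v i * w j)) -
        2 * a * b * (M i j * (w i * v j)) + 4 * b ^ 2 * (M i j * (w i * w j)) := by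
    intro i j
    ring
  simp only [h1, Finset.sum_add_distrib, Finset.sum_sub_distrib, ← Finset.mul_sum]
  rw [hv, ← ha, ← hb, ← hb']
  ring

theorem map_bundlePoly {S T σ : Type*} [CommRing S] [Algebra k S] [CommRing T] [Algebra k T]
    (g : S →ₐ[k] T) (f : Fin (d + 1) → MvPolynomial σ k) (x y : S) :
    map (g : S →+* T) (bundlePoly f x y) = bundlePoly f (g x) (g y) := by
  simp only [bundlePoly, map_sum, map_mul, map_C, map_map, map_pow, RingHom.coe_coe,
    AlgHom.comp_algebraMap_of_tower]

theorem bundlePoly_mul {S σ : Type*} [CommRing S] [Algebra k S]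
    (f : Fin (d + 1) → MvPolynomial σ k) (c x y : S) :
    bundlePoly f (c * x) (c * y) = C (c ^ d) * bundlePoly f x y := by
  rw [bundlePoly, bundlePoly, Finset.mul_sum]
  refine Finset.sum_congr rfl fun t _ => ?_
  rw [← mul_assoc, ← C_mul]
  have : c ^ d = c ^ (d - (t : ℕ)) * c ^ (t : ℕ) := by
    rw [← pow_add, Nat.sub_add_cancel (Nat.lt_succ_iff.mp t.2)]
  congr 2
  rw [this]
  ring

theorem binaryForm_mul {S : Type*} [CommRing S] (z : Fin d → S) (c x y : S) :
    binaryForm z (c * x) (c * y) = c ^ (d - 1) * binaryForm z x y := by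
  rw [binaryForm, binaryForm, Finset.mul_sum]
  refine Finset.sum_congr rfl fun t _ => ?_
  have : c ^ (d - 1) = c ^ (d - 1 - (t : ℕ)) * c ^ (t : ℕ) := by
    rw [← pow_add]
    congr 1
    have := t.2
    omega
  rw [this]
  ring

/-- The coefficients of `f_0` and `f_d` are `x ^ d` and `y ^ d`. -/
theorem eq_zero_of_bundlePoly_eq_zero {S σ : Type*} [CommRing S] [IsReduced S] [Algebra k S]
    {f : Fin (d + 1) → MvPolynomial σ k} (hf : LinearIndependent k f) {x y : S}
    (h : bundlePoly f x y = 0) : x = 0 ∧ y = 0 := by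
  have h1 := eq_zero_of_sum_C_mul_map_eq_zero hf h
  have h0 := h1 0
  have hd := h1 (Fin.last d)
  simp only [Fin.val_zero, pow_zero, mul_one, Fin.val_last, Nat.sub_self, one_mul,
    Nat.sub_zero] at h0 hd
  exact ⟨eq_zero_of_pow_eq_zero h0, eq_zero_of_pow_eq_zero hd⟩

/-- Modulo `g` the form vanishes, so linear independence over the quotient makes `g` divide both `x
^ d` and `y ^ d`, which are coprime. -/
theorem isUnit_of_C_dvd_bundlePoly {S σ : Type*} [CommRing S] [IsDomain S]
    [UniqueFactorizationMonoid S] [Algebra k S]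
    {f : Fin (d + 1) → MvPolynomial σ k} (hf : LinearIndependent k f) {x y : S}
    (hxy : IsRelPrime x y) {g : S} (h : C g ∣ bundlePoly f x y) : IsUnit g := by
  have h0 : bundlePoly f (Ideal.Quotient.mkₐ k (Ideal.span {g}) x)
      (Ideal.Quotient.mkₐ k (Ideal.span {g}) y) = 0 := by
    rw [← map_bundlePoly]
    obtain ⟨r, hr⟩ := h
    have hg : Ideal.Quotient.mkₐ k (Ideal.span {g}) g = 0 :=
      Ideal.Quotient.eq_zero_iff_mem.mpr (Ideal.mem_span_singleton_self g)
    rw [hr, map_mul, map_C, RingHom.coe_coe, hg, C_0, zero_mul]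
  have h1 := eq_zero_of_sum_C_mul_map_eq_zero hf h0
  have h2 := h1 0
  have h3 := h1 (Fin.last d)
  simp only [Fin.val_zero, pow_zero, mul_one, Fin.val_last, Nat.sub_self, one_mul,
    Nat.sub_zero, ← map_pow] at h2 h3
  have h2' := Ideal.mem_span_singleton.mp (Ideal.Quotient.eq_zero_iff_mem.mp h2)
  have h3' := Ideal.mem_span_singleton.mp (Ideal.Quotient.eq_zero_iff_mem.mp h3)
  exact (hxy.pow (m := d) (n := d)) h2' h3'

theorem isUnit_of_dvd_bundlePoly {S σ : Type*} [CommRing S] [IsDomain S]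
    [UniqueFactorizationMonoid S] [Algebra k S]
    {f : Fin (d + 1) → MvPolynomial σ k} (hf : LinearIndependent k f) {x y : S}
    (hxy : IsRelPrime x y) {g : MvPolynomial σ S} (h : g ∣ bundlePoly f x y)
    (hg : g.totalDegree = 0) : IsUnit g := by
  rw [totalDegree_eq_zero_iff_eq_C] at hg
  rw [hg] at h ⊢
  exact (isUnit_of_C_dvd_bundlePoly hf hxy h).map C

theorem isHomogeneous_bundlePoly {S σ : Type*} [CommRing S] [Algebra k S]
    {f : Fin (d + 1) → MvPolynomial σ k} (hf : ∀ i, (f i).IsHomogeneous 2) (x y : S) :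
    (bundlePoly f x y).IsHomogeneous 2 :=
  IsHomogeneous.sum _ _ _ fun t _ => ((hf t).map _).C_mul _

theorem eval₂_map_eq {S σ τ : Type*} [CommRing S] [Algebra k S] (ψ : σ → MvPolynomial τ k)
    (p : MvPolynomial σ k) :
    eval₂Hom C (fun s => map (algebraMap k S) (ψ s)) (map (algebraMap k S) p) =
      map (algebraMap k S) (aeval ψ p) := by
  have : (eval₂Hom C (fun s => map (algebraMap k S) (ψ s))).comp (map (algebraMap k S)) =
      (map (algebraMap k S)).comp (aeval ψ : MvPolynomial σ k →ₐ[k] MvPolynomial τ k).toRingHom := by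
    ext <;> simp
  exact RingHom.congr_fun this p

theorem binaryForm_transcendental_ne_zero {z : Fin d → k} (hz : z ≠ 0) {E : Type*}
    [Field E] [Algebra k E] {u : E} (hu : Transcendental k u) :
    binaryForm (fun j => algebraMap k E (z j)) u 1 ≠ 0 := by
  intro h0
  obtain ⟨t, ht, -⟩ := exists_min_ne_zero hz
  let P : Polynomial k := ∑ j : Fin d, Polynomial.monomial (d - 1 - (j : ℕ)) (z j)
  have hP : Polynomial.aeval u P = 0 := by
    rw [← h0]
    simp only [P, binaryForm, map_sum, Polynomial.aeval_monomial, one_pow, mul_one]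
    exact Finset.sum_congr rfl fun j _ => mul_comm _ _
  have hP0 : P = 0 := (transcendental_iff.mp hu) P hP
  have hcoeff := congrArg (fun P => Polynomial.coeff P (d - 1 - (t : ℕ))) hP0
  simp only [P, Polynomial.finsetSum_coeff, Polynomial.coeff_monomial, Polynomial.coeff_zero]
    at hcoeff
  rw [Finset.sum_eq_single t] at hcoeff
  · simp only [if_true] at hcoeff
    exact ht hcoeff
  · intro j _ hj
    rw [if_neg]
    intro hjt
    apply hj
    apply Fin.ext
    have := j.2
    have := t.2
    omega
  · simp

/-- A zero of a pencil of quadratic forms is not a vertex if the forms take values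
`a_t A + b_t B` there with `A / B` the transcendental parameter of the pencil. -/
theorem exists_bundleGram_ne_zero {E ι : Type*} [Field E] [Algebra k E] [Fintype ι] {z : Fin d → k}
    (hz : z ≠ 0) {f : Fin (d + 1) → MvPolynomial ι k} {G : Fin (d + 1) → Matrix ι ι k}
    (hGs : ∀ t, (G t).transpose = G t) (hG : ∀ t, f t = ∑ i, ∑ j, C (G t i j) * (X i * X j))
    {A B : E} (hm : B ≠ 0) (hu : Transcendental k (A / B)) {φE : ι → E}
    (hval : ∀ t, aeval φE (f t) = algebraMap k E (lowerColumn z t) * A +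
      algebraMap k E (upperColumn z t) * B) :
    ∃ i, ∑ j, bundleGram G A B i j * φE j ≠ 0 := by
  by_contra! h0
  set u := A / B with hudef
  have hA' : A = B * u := (mul_div_cancel₀ _ hm).symm
  let M : Matrix ι ι (Polynomial k) := bundleGram G Polynomial.X 1
  have hM : ∀ i j, M i j =
      ∑ t : Fin (d + 1), Polynomial.X ^ (d - (t : ℕ)) * Polynomial.C (G t i j) := by
    intro i j
    refine (bundleGram_apply G Polynomial.X 1 i j).trans (Finset.sum_congr rfl fun t _ => ?_)
    rw [one_pow, mul_one]
    rfl
  have hMu : ∀ i, ∑ j, Polynomial.aeval u (M i j) * φE j = 0 := by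
    intro i
    refine (mul_eq_zero.mp ?_).resolve_left (pow_ne_zero d hm)
    rw [← h0 i, Finset.mul_sum]
    refine Finset.sum_congr rfl fun j _ => ?_
    rw [← mul_assoc]
    congr 1
    rw [hM, bundleGram_apply, map_sum, Finset.mul_sum]
    refine Finset.sum_congr rfl fun t _ => ?_
    rw [map_mul, map_pow, Polynomial.aeval_X, Polynomial.aeval_C, hA', ← mul_assoc]
    congr 1
    have : B ^ d = B ^ (d - (t : ℕ)) * B ^ (t : ℕ) := by
      rw [← pow_add, Nat.sub_add_cancel (Nat.lt_succ_iff.mp t.2)]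
    rw [this]
    ring
  have key := sum_derivative_eq_zero hu (bundleGram_symm hGs _ _) hMu
  have hderiv : ∑ i, ∑ j, φE i * (Polynomial.aeval u (Polynomial.derivative (M i j)) * φE j) =
      ∑ t : Fin (d + 1), Polynomial.aeval u (Polynomial.derivative
        (Polynomial.X ^ (d - (t : ℕ)) : Polynomial k)) * aeval φE (f t) := by
    have h1 : ∀ t, aeval φE (f t) = ∑ i, ∑ j, algebraMap k E (G t i j) * (φE i * φE j) := by
      intro t
      conv_lhs => rw [hG t]
      simp
    simp only [h1, hM, map_sum, Finset.sum_mul, Finset.mul_sum]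
    rw [eq_comm, Finset.sum_comm]
    refine Finset.sum_congr rfl fun i _ => ?_
    rw [Finset.sum_comm]
    refine Finset.sum_congr rfl fun j _ => Finset.sum_congr rfl fun t _ => ?_
    rw [Polynomial.derivative_mul, Polynomial.derivative_C, mul_zero,
      add_zero, map_mul, Polynomial.aeval_C]
    ring
  -- The value of the pencil at the fixed vector `φE` as a function of the parameter. An isotropic
  -- derivative would make `u` a multiple zero of `P`, but the linear factor vanishes at `u` and the
  -- binary form does not.
  let P : Polynomial E := (Polynomial.C B * Polynomial.X - Polynomial.C A) *
    binaryForm (fun j => Polynomial.C (algebraMap k E (z j))) Polynomial.X 1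
  have hP : P = ∑ t : Fin (d + 1), (Polynomial.X ^ (d - (t : ℕ)) : Polynomial E) *
      Polynomial.C (aeval φE (f t)) := by
    have h1 := sum_lowerColumn (fun j => Polynomial.C (algebraMap k E (z j))) Polynomial.X 1
    have h2 := sum_upperColumn (fun j => Polynomial.C (algebraMap k E (z j))) Polynomial.X 1
    have h3 : ∀ t, Polynomial.C (aeval φE (f t)) =
        lowerColumn (fun j => Polynomial.C (algebraMap k E (z j))) t * Polynomial.C A +
        upperColumn (fun j => Polynomial.C (algebraMap k E (z j))) t * Polynomial.C B := by
      intro t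
      rw [hval, Polynomial.C_add, Polynomial.C_mul, Polynomial.C_mul,
        map_lowerColumn (algebraMap k E), map_upperColumn (algebraMap k E),
        map_lowerColumn Polynomial.C, map_upperColumn Polynomial.C]
    simp only [one_pow, mul_one, one_mul] at h1 h2
    simp only [h3, mul_add, ← mul_assoc, Finset.sum_add_distrib, ← Finset.sum_mul, h1, h2, P]
    ring
  have hPder : Polynomial.eval u (Polynomial.derivative P) = 0 := by
    rw [← key, hderiv, hP, Polynomial.derivative_sum, Polynomial.eval_finsetSum]
    refine Finset.sum_congr rfl fun t _ => ?_
    rw [Polynomial.derivative_mul, Polynomial.derivative_C, mul_zero, add_zero,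
      Polynomial.eval_mul, Polynomial.eval_C, Polynomial.aeval_def, Polynomial.eval₂_eq_eval_map,
      ← Polynomial.derivative_map, Polynomial.map_pow, Polynomial.map_X]
  have hP2 : Polynomial.eval u (Polynomial.derivative P) =
      B * binaryForm (fun j => algebraMap k E (z j)) u 1 := by
    have hbin : Polynomial.eval u (binaryForm (fun j => Polynomial.C (algebraMap k E (z j)))
        Polynomial.X 1) = binaryForm (fun j => algebraMap k E (z j)) u 1 := by
      have := map_binaryForm (Polynomial.evalRingHom u)
        (fun j => Polynomial.C (algebraMap k E (z j))) Polynomial.X 1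
      simpa using this
    have hlin : Polynomial.eval u (Polynomial.C B * Polynomial.X - Polynomial.C A) = 0 := by
      rw [Polynomial.eval_sub, Polynomial.eval_mul, Polynomial.eval_C, Polynomial.eval_X,
        Polynomial.eval_C, ← hA', sub_self]
    have hder : Polynomial.derivative (Polynomial.C B * Polynomial.X - Polynomial.C A) =
        Polynomial.C B := by simp
    rw [Polynomial.derivative_mul, Polynomial.eval_add, Polynomial.eval_mul, Polynomial.eval_mul,
      hbin, hlin, hder, Polynomial.eval_C, zero_mul, add_zero]
  rw [hPder] at hP2
  exact mul_ne_zero hm (binaryForm_transcendental_ne_zero hz hu) hP2.symm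

end Bundle

/-! ### The parametrising point is not a vertex -/

namespace IsColumnParametrization

variable {k : Type*} [Field k] {n d N : ℕ} {f : Fin (d + 1) → MvPolynomial (Fin (n + 1)) k}
  {z : Fin d → k} {l m : MvPolynomial (Fin (n + 1)) k}
  {φ : Fin (n + 1) → MvPolynomial (Fin (N + 1)) k}

theorem binaryForm_ne_zero (h : IsColumnParametrization f z l m φ) :
    binaryForm (fun j => (C (z j) : MvPolynomial (Fin (N + 1)) k)) (aeval φ l) (aeval φ m) ≠ 0 := by
  intro h0
  let E := FractionRing (MvPolynomial (Fin (N + 1)) k)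
  have hm : algebraMap _ E (aeval φ m) ≠ 0 := by simpa using h.m_ne_zero
  have h1 := congrArg (algebraMap (MvPolynomial (Fin (N + 1)) k) E) h0
  rw [map_binaryForm, map_zero] at h1
  refine binaryForm_transcendental_ne_zero h.ne_zero h.transcendental ?_
  have h2 := binaryForm_mul (fun j => algebraMap k E (z j)) (algebraMap _ E (aeval φ m))
    (algebraMap _ E (aeval φ l) / algebraMap _ E (aeval φ m)) 1
  rw [mul_div_cancel₀ _ hm, mul_one] at h2
  have h3 : binaryForm (fun j => algebraMap k E (z j)) (algebraMap _ E (aeval φ l))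
      (algebraMap _ E (aeval φ m)) = 0 := h1
  rw [h3] at h2
  exact (mul_eq_zero.mp h2.symm).resolve_left (pow_ne_zero _ hm)

/-- The point `φ` is not a vertex of the quadric over `[λ(φ) : μ(φ)]`. -/
theorem exists_polar_ne_zero (h : IsColumnParametrization f z l m φ)
    {G : Fin (d + 1) → Matrix (Fin (n + 1)) (Fin (n + 1)) k} (hGs : ∀ t, (G t).transpose = G t)
    (hG : ∀ t, f t = ∑ i, ∑ j, C (G t i j) * (X i * X j)) :
    ∃ i, ∑ j, bundleGram G (aeval φ l) (aeval φ m) i j * φ j ≠ 0 := by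
  let g := IsScalarTower.toAlgHom k (MvPolynomial (Fin (N + 1)) k)
    (FractionRing (MvPolynomial (Fin (N + 1)) k))
  have hg : Function.Injective g := IsFractionRing.injective _ _
  obtain ⟨i, hi⟩ := exists_bundleGram_ne_zero (φE := fun j => g (φ j)) h.ne_zero hGs hG
    ((map_ne_zero_iff g hg).mpr h.m_ne_zero) h.transcendental (fun t => by
      have h1 := h.aeval_column g 1 t
      simp only [one_mul, one_pow] at h1
      exact h1)
  refine ⟨i, fun h0 => hi ?_⟩
  rw [← map_zero g, ← h0, map_sum]
  refine Finset.sum_congr rfl fun j _ => ?_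
  rw [map_mul, bundleGram_apply, bundleGram_apply, map_sum]
  congr 1
  refine Finset.sum_congr rfl fun t _ => ?_
  rw [map_mul, map_mul, map_pow, map_pow, AlgHom.commutes]
  rfl

end IsColumnParametrization

/-! ### Irreducibility of the quadric over the generic parameter -/

section Prime

variable {k : Type*} [Field k] {n d N : ℕ} {f : Fin (d + 1) → MvPolynomial (Fin (n + 1)) k}
  {z : Fin d → k} {l m : MvPolynomial (Fin (n + 1)) k}
  {φ : Fin (n + 1) → MvPolynomial (Fin (N + 1)) k}

theorem isHomogeneous_binaryForm {R τ : Type*} [CommRing R] {A B : MvPolynomial τ R} {e : ℕ}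
    (hA : A.IsHomogeneous e) (hB : B.IsHomogeneous e) (z : Fin d → R) :
    (binaryForm (fun j => (C (z j) : MvPolynomial τ R)) A B).IsHomogeneous (e * (d - 1)) := by
  refine IsHomogeneous.sum _ _ _ fun j _ => ?_
  have h := (((hA.pow (d - 1 - (j : ℕ))).mul (hB.pow (j : ℕ))).mul (isHomogeneous_C τ (z j)))
  convert h using 1
  rw [← mul_add, add_zero]
  congr 1
  have := j.2
  omega

namespace IsColumnParametrization

/-- The binary form at `(λ(φ), μ(φ))` is homogeneous of degree `2e(d-1)` and equals `c^{d-1}` times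
its value at `(a, b)`. If that value were a unit, `c` would have degree at least `2e`; then `a` and
`b` would be constants and `λ(φ)`, `μ(φ)` proportional. -/
theorem not_isUnit_binaryForm (h : IsColumnParametrization f z l m φ)
    {a b c : MvPolynomial (Fin (N + 1)) k} (ha : c * a = aeval φ l) (hb : c * b = aeval φ m) :
    ¬ IsUnit (binaryForm (fun j => (C (z j) : MvPolynomial (Fin (N + 1)) k)) a b) := by
  intro hunit
  obtain ⟨e, he⟩ := h.exists_degree
  have hA : (aeval φ l).IsHomogeneous (e * 2) := h.isHomogeneous_l.aeval _ he
  have hB : (aeval φ m).IsHomogeneous (e * 2) := h.isHomogeneous_m.aeval _ he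
  have hdeg := (isHomogeneous_binaryForm hA hB z).totalDegree h.binaryForm_ne_zero
  have hu := (isUnit_iff_totalDegree_of_isReduced.mp hunit).2
  have hle : e * 2 * (d - 1) ≤ (d - 1) * c.totalDegree := by
    rw [← hdeg, ← ha, ← hb, binaryForm_mul]
    refine (totalDegree_mul _ _).trans ?_
    rw [hu, add_zero]
    exact totalDegree_pow _ _
  have hle' : e * 2 ≤ c.totalDegree := by
    have := h.one_lt
    rw [mul_comm] at hle
    exact Nat.le_of_mul_le_mul_left hle (by omega)
  have key : ∀ {a A : MvPolynomial (Fin (N + 1)) k}, c * a = A → A ≠ 0 →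
      A.IsHomogeneous (e * 2) → a = C (coeff 0 a) := by
    intro a A haA hA0 hA
    rw [← totalDegree_eq_zero_iff_eq_C]
    have h1 := hA.totalDegree hA0
    rw [← haA] at hA0 h1
    rw [totalDegree_mul_of_isDomain (left_ne_zero_of_mul hA0) (right_ne_zero_of_mul hA0)] at h1
    omega
  have ha' := key ha h.l_ne_zero hA
  have hb' := key hb h.m_ne_zero hB
  obtain ⟨hb0, -⟩ := h.independent_aeval (coeff 0 b) (-coeff 0 a) (by
    rw [C_neg, ← ha', ← hb', ← ha, ← hb]
    ring)
  rw [hb0, C_0] at hb'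
  exact h.m_ne_zero (by rw [← hb, hb', mul_zero])

/-- Over a zero of the binary form of `z`, a product of two polynomials of degree at most one that
equals the quadratic form is zero. -/
theorem bundlePoly_eq_zero_of_mul (h : IsColumnParametrization f z l m φ) {S : Type*} [CommRing S]
    [IsDomain S] [Algebra k S] {x y : S} (hxy : binaryForm (fun j => algebraMap k S (z j)) x y = 0)
    {P Q : MvPolynomial (Fin (n + 1)) S} (hP : P.totalDegree ≤ 1) (hQ : Q.totalDegree ≤ 1)
    (hPQ : P * Q = bundlePoly f x y) : bundlePoly f x y = 0 := by
  let ψ : Fin (n + 1) → MvPolynomial (Unit ⊕ Fin (N + 1)) k :=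
    fun j => X (Sum.inl ()) * rename Sum.inr (φ j)
  have hψ : ∀ p : MvPolynomial (Fin (n + 1)) k, p.totalDegree ≤ 1 → aeval ψ p = 0 → p = 0 :=
    fun p hp hp0 => h.eq_zero p ((h.mem_iff p).mpr hp0) hp
  -- Evaluation at the generic point of the cone over `X_z`, with scalars extended to `S`. The
  -- target is a domain, so one of the two factors vanishes there, and `X_z` satisfies no non-zero
  -- equation of degree at most one.
  let ev := eval₂Hom (C : S →+* MvPolynomial (Unit ⊕ Fin (N + 1)) S)
    fun s => map (algebraMap k S) (ψ s)
  obtain ⟨lv, mv, hlm⟩ : ∃ lv mv : MvPolynomial (Unit ⊕ Fin (N + 1)) S, ∀ t,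
      ev (map (algebraMap k S) (f t)) =
        C (algebraMap k S (lowerColumn z t)) * lv + C (algebraMap k S (upperColumn z t)) * mv := by
    refine ⟨map (algebraMap k S) (X (Sum.inl ()) ^ 2 * rename Sum.inr (aeval φ l)),
      map (algebraMap k S) (X (Sum.inl ()) ^ 2 * rename Sum.inr (aeval φ m)), fun t => ?_⟩
    have h1 := h.aeval_column (rename Sum.inr) (X (Sum.inl ())) t
    have h2 : ev (map (algebraMap k S) (f t)) = map (algebraMap k S) (aeval ψ (f t)) :=
      eval₂_map_eq ψ (f t)
    rw [h2, h1, map_add, map_mul, map_mul _ (algebraMap k _ _), MvPolynomial.algebraMap_eq, map_C,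
      map_C]
  have hev : ev (bundlePoly f x y) = 0 := by
    have h1 := congrArg (C : S →+* MvPolynomial (Unit ⊕ Fin (N + 1)) S)
      (sum_lowerColumn (fun j => algebraMap k S (z j)) x y)
    have h2 := congrArg (C : S →+* MvPolynomial (Unit ⊕ Fin (N + 1)) S)
      (sum_upperColumn (fun j => algebraMap k S (z j)) x y)
    simp only [← map_lowerColumn, ← map_upperColumn, hxy, mul_zero, neg_zero, C_0, map_sum,
      C_mul] at h1 h2
    have hevC : ∀ s, ev (C s) = C s := fun s => eval₂Hom_C _ _ s
    simp only [bundlePoly, map_sum, map_mul, hevC, hlm, mul_add, ← mul_assoc,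
      Finset.sum_add_distrib, ← Finset.sum_mul]
    rw [h1, h2, zero_mul, zero_mul, add_zero]
  rw [← hPQ, map_mul, mul_eq_zero] at hev
  rw [← hPQ]
  rcases hev with h0 | h0
  · rw [eq_zero_of_eval₂_eq_zero hψ hP h0, zero_mul]
  · rw [eq_zero_of_eval₂_eq_zero hψ hQ h0, mul_zero]

theorem totalDegree_map_le' {R S σ : Type*} [CommRing R] [CommRing S] (g : R →+* S)
    (p : MvPolynomial σ R) : (map g p).totalDegree ≤ p.totalDegree :=
  Finset.sup_mono (support_map_subset g p)

/-- The equation of the quadric over the generic point of the parameter space is prime. -/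
theorem prime_bundlePoly (h : IsColumnParametrization f z l m φ)
    {a b c : MvPolynomial (Fin (N + 1)) k} (hab : IsRelPrime a b) (ha : c * a = aeval φ l)
    (hb : c * b = aeval φ m) : Prime (bundlePoly f a b) := by
  have ha0 : a ≠ 0 := fun h0 => h.l_ne_zero (by rw [← ha, h0, mul_zero])
  have hne : bundlePoly f a b ≠ 0 := fun h0 =>
    ha0 (eq_zero_of_bundlePoly_eq_zero h.linearIndependent h0).1
  have hdeg := (isHomogeneous_bundlePoly h.isHomogeneous a b).totalDegree hne
  refine Irreducible.prime ⟨fun hu => ?_, fun P Q hPQ => ?_⟩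
  · have := (isUnit_iff_totalDegree_of_isReduced.mp hu).2
    omega
  have hP0 : P ≠ 0 := fun h0 => hne (by rw [hPQ, h0, zero_mul])
  have hQ0 : Q ≠ 0 := fun h0 => hne (by rw [hPQ, h0, mul_zero])
  have hsum : P.totalDegree + Q.totalDegree = 2 := by
    rw [← totalDegree_mul_of_isDomain hP0 hQ0, ← hPQ, hdeg]
  by_cases hP : P.totalDegree = 0
  · exact Or.inl (isUnit_of_dvd_bundlePoly h.linearIndependent hab ⟨Q, hPQ⟩ hP)
  by_cases hQ : Q.totalDegree = 0
  · exact Or.inr (isUnit_of_dvd_bundlePoly h.linearIndependent hab ⟨P, by rw [hPQ, mul_comm]⟩ hQ)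
  exfalso
  set Z := binaryForm (fun j => (C (z j) : MvPolynomial (Fin (N + 1)) k)) a b with hZ
  have hZ0 : Z ≠ 0 := by
    intro h0
    apply h.binaryForm_ne_zero
    rw [← ha, ← hb, binaryForm_mul, ← hZ, h0, mul_zero]
  -- Both factors are now of degree one. Modulo a prime factor of the binary form at `(a, b)` the
  -- quadratic form vanishes on `X_z`.
  obtain ⟨π, hπ, hπZ⟩ := WfDvdMonoid.exists_irreducible_factor
    (h.not_isUnit_binaryForm ha hb) hZ0
  have hprime : (Ideal.span {π}).IsPrime := (Ideal.span_singleton_prime hπ.ne_zero).mpr hπ.prime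
  let g := Ideal.Quotient.mkₐ k (Ideal.span {π})
  have hg : ∀ {r}, g r = 0 → π ∣ r := fun hr =>
    Ideal.mem_span_singleton.mp (Ideal.Quotient.eq_zero_iff_mem.mp hr)
  have hgZ : binaryForm (fun j => algebraMap k (MvPolynomial (Fin (N + 1)) k ⧸ Ideal.span {π}) (z j))
      (g a) (g b) = 0 := by
    have h1 := map_binaryForm g.toRingHom (fun j => C (z j)) a b
    have h2 : g Z = 0 := Ideal.Quotient.eq_zero_iff_mem.mpr (Ideal.mem_span_singleton.mpr hπZ)
    exact h1.symm.trans h2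
  have h0 := h.bundlePoly_eq_zero_of_mul hgZ (P := map g.toRingHom P) (Q := map g.toRingHom Q)
    ((totalDegree_map_le' _ _).trans (by omega)) ((totalDegree_map_le' _ _).trans (by omega))
    (by rw [← map_mul, ← hPQ]; exact map_bundlePoly g f a b)
  obtain ⟨h1, h2⟩ := eq_zero_of_bundlePoly_eq_zero h.linearIndependent h0
  exact hπ.not_isUnit (hab (hg h1) (hg h2))

end IsColumnParametrization

end Prime

/-! ### Parametrisation of the quadric bundle -/

section BundleParametrization

variable {k : Type*} [Field k] {n d N : ℕ} {f : Fin (d + 1) → MvPolynomial (Fin (n + 1)) k}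
  {z : Fin d → k} {l m : MvPolynomial (Fin (n + 1)) k}
  {φ : Fin (n + 1) → MvPolynomial (Fin (N + 1)) k}

/-- If a polynomial vanishes at the generic multiple of `r w`, for a non-zero element `r` of a
domain, then it vanishes at the generic multiple of `w`. -/
theorem eq_zero_of_comp_eq_zero {R : Type*} [CommRing R] [IsDomain R] {r : R} (hr : r ≠ 0)
    {P : Polynomial R} (h : P.comp (Polynomial.C r * Polynomial.X) = 0) : P = 0 := by
  ext i
  have hi := congrArg (fun P => Polynomial.coeff P i) h
  simp only [Polynomial.comp_C_mul_X_coeff, Polynomial.coeff_zero] at hi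
  rw [Polynomial.coeff_zero]
  exact (mul_eq_zero.mp hi).resolve_right (pow_ne_zero _ hr)

/-- Polynomials on the product seen as polynomials in the second block of variables. -/
noncomputable def iterate (k : Type*) [Field k] (σ τ : Type*) :
    MvPolynomial (σ ⊕ τ) k →ₐ[k] MvPolynomial τ (MvPolynomial σ k) :=
  aeval (Sum.elim (fun i => C (X i)) X)

theorem iterate_rename_inl {σ τ : Type*} (p : MvPolynomial σ k) :
    iterate k σ τ (rename Sum.inl p) = C p := by
  rw [iterate, aeval_rename, Sum.elim_comp_inl]
  have h := comp_aeval_apply (R := k) (f := X) (Algebra.ofId (MvPolynomial σ k)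
    (MvPolynomial τ (MvPolynomial σ k)) |>.restrictScalars k) p
  rw [aeval_X_left_apply] at h
  exact h.symm

theorem iterate_rename_inr {σ τ : Type*} (p : MvPolynomial τ k) :
    iterate k σ τ (rename Sum.inr p) = map (algebraMap k (MvPolynomial σ k)) p := by
  have h : (iterate k σ τ).toRingHom.comp (rename Sum.inr : MvPolynomial τ k →ₐ[k] _).toRingHom =
      map (algebraMap k (MvPolynomial σ k)) := by
    apply MvPolynomial.ringHom_ext
    · intro r
      simp [iterate, MvPolynomial.algebraMap_eq, MvPolynomial.algebraMap_apply]
    · intro i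
      simp [iterate]
  exact RingHom.congr_fun h p

theorem dvd_of_iterate_dvd {σ τ : Type*} {p q : MvPolynomial (σ ⊕ τ) k}
    (h : iterate k σ τ p ∣ iterate k σ τ q) : p ∣ q := by
  let inv : MvPolynomial τ (MvPolynomial σ k) →+* MvPolynomial (σ ⊕ τ) k :=
    eval₂Hom (rename Sum.inl : MvPolynomial σ k →ₐ[k] _).toRingHom fun j => X (Sum.inr j)
  have hinv : inv.comp (iterate k σ τ).toRingHom = RingHom.id _ := by
    apply MvPolynomial.ringHom_ext
    · intro r
      simp [inv, iterate, MvPolynomial.algebraMap_eq, MvPolynomial.algebraMap_apply]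
    · rintro (i | j) <;> simp [inv, iterate]
  have h1 := map_dvd inv h
  have h2 : ∀ p, inv (iterate k σ τ p) = p := fun p => RingHom.congr_fun hinv p
  rwa [h2, h2] at h1

theorem iterate_divisorForm (f : Fin (d + 1) → MvPolynomial (Fin (n + 1)) k) :
    iterate k (Fin 2) (Fin (n + 1)) (divisorForm f) = bundlePoly f (X 0) (X 1) := by
  simp only [divisorForm, map_sum, map_mul, map_pow, iterate_rename_inr, bundlePoly]
  simp only [iterate, aeval_X, Sum.elim_inl]

theorem isRelPrime_X_zero_X_one : IsRelPrime (X 0 : MvPolynomial (Fin 2) k) (X 1) := by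
  rw [(X_prime (R := k) (i := (0 : Fin 2))).irreducible.isRelPrime_iff_not_dvd, X_dvd_X]
  exact zero_ne_one

/-- Divisibility by the equation of the divisor can be tested over a field that contains the
coordinate ring of the base. -/
theorem divisorForm_dvd_of_map_dvd (hf : LinearIndependent k f) {E : Type*} [Field E]
    [Algebra k E] {g : MvPolynomial (Fin 2) k →ₐ[k] E} (hg : Function.Injective g)
    {p : MvPolynomial (Fin 2 ⊕ Fin (n + 1)) k}
    (h : bundlePoly f (g (X 0)) (g (X 1)) ∣ map g.toRingHom (iterate k _ _ p)) :
    divisorForm f ∣ p := by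
  have h1 : map g.toRingHom (bundlePoly f (X 0) (X 1)) ∣ map g.toRingHom (iterate k _ _ p) := by
    have h2 := map_bundlePoly g f (X 0) (X 1)
    exact (show map g.toRingHom (bundlePoly f (X 0) (X 1)) = _ from h2) ▸ h
  obtain ⟨c, hc, hdvd⟩ := exists_dvd_C_mul_of_map_dvd_map (f := g.toRingHom) hg h1
  apply dvd_of_iterate_dvd
  rw [iterate_divisorForm]
  -- The constant `c` lost in the descent is cancelled: `X 0` and `X 1` are coprime, so the form has
  -- no non-unit divisor free of the `y` variables.
  have hrel : IsRelPrime (bundlePoly f (X 0) (X 1)) (C c : MvPolynomial (Fin (n + 1)) _) := by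
    intro r hr hrc
    refine isUnit_of_dvd_bundlePoly hf isRelPrime_X_zero_X_one hr ?_
    have := totalDegree_le_of_dvd_of_isDomain hrc ((C_ne_zero).mpr hc)
    rw [totalDegree_C] at this
    omega
  exact hrel.dvd_of_dvd_mul_left hdvd

/-- The value of the quadratic form at the generic point. -/
noncomputable def genericValue (f : Fin (d + 1) → MvPolynomial (Fin (n + 1)) k)
    (l m : MvPolynomial (Fin (n + 1)) k) (φ : Fin (n + 1) → MvPolynomial (Fin (N + 1)) k) :
    MvPolynomial (Fin (N + 1) ⊕ Fin (n + 1)) k :=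
  ∑ t : Fin (d + 1), rename Sum.inl (aeval φ l) ^ (d - (t : ℕ)) *
    rename Sum.inl (aeval φ m) ^ (t : ℕ) * rename Sum.inr (f t)

/-- The value of the polar form at the point `φ` and the generic point. -/
noncomputable def genericPolar (G : Fin (d + 1) → Matrix (Fin (n + 1)) (Fin (n + 1)) k)
    (l m : MvPolynomial (Fin (n + 1)) k) (φ : Fin (n + 1) → MvPolynomial (Fin (N + 1)) k) :
    MvPolynomial (Fin (N + 1) ⊕ Fin (n + 1)) k :=
  ∑ i, ∑ j, bundleGram G (rename Sum.inl (aeval φ l)) (rename Sum.inl (aeval φ m)) i j *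
    (rename Sum.inl (φ i) * X (Sum.inr j))

/-- The coordinates of the rational map to the quadric bundle: the residual intersection of the
quadric with the line through the point `φ` and the generic point. -/
noncomputable def bundleCoord (f : Fin (d + 1) → MvPolynomial (Fin (n + 1)) k)
    (G : Fin (d + 1) → Matrix (Fin (n + 1)) (Fin (n + 1)) k)
    (l m : MvPolynomial (Fin (n + 1)) k) (φ : Fin (n + 1) → MvPolynomial (Fin (N + 1)) k) :
    Fin 2 ⊕ Fin (n + 1) → MvPolynomial (Fin (N + 1) ⊕ Fin (n + 1)) k :=
  Sum.elim ![rename Sum.inl (aeval φ l), rename Sum.inl (aeval φ m)] fun j =>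
    genericValue f l m φ * rename Sum.inl (φ j) - 2 * genericPolar G l m φ * X (Sum.inr j)

theorem iterate_genericValue (f : Fin (d + 1) → MvPolynomial (Fin (n + 1)) k)
    (l m : MvPolynomial (Fin (n + 1)) k) (φ : Fin (n + 1) → MvPolynomial (Fin (N + 1)) k) :
    iterate k _ _ (genericValue f l m φ) = bundlePoly f (aeval φ l) (aeval φ m) := by
  simp only [genericValue, map_sum, map_mul, map_pow, iterate_rename_inr, iterate_rename_inl,
    bundlePoly]

theorem iterate_genericPolar (G : Fin (d + 1) → Matrix (Fin (n + 1)) (Fin (n + 1)) k)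
    (l m : MvPolynomial (Fin (n + 1)) k) (φ : Fin (n + 1) → MvPolynomial (Fin (N + 1)) k) :
    iterate k _ _ (genericPolar G l m φ) =
      ∑ j, C (∑ i, bundleGram G (aeval φ l) (aeval φ m) i j * φ i) * X j := by
  have hX : ∀ j, iterate k (Fin (N + 1)) (Fin (n + 1)) (X (Sum.inr j)) = X j := fun j => by
    simp [iterate]
  simp only [genericPolar, bundleGram_apply, map_sum, map_mul, map_pow, iterate_rename_inl,
    AlgHom.commutes, hX]
  rw [Finset.sum_comm]
  refine Finset.sum_congr rfl fun j _ => ?_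
  rw [Finset.sum_mul]
  refine Finset.sum_congr rfl fun i _ => ?_
  rw [mul_assoc]
  rfl

theorem bundleCoord_isHomogeneous {e : ℕ} (he : ∀ j, (φ j).IsHomogeneous e)
    (hf : ∀ i, (f i).IsHomogeneous 2) (hl : l.IsHomogeneous 2) (hm : m.IsHomogeneous 2)
    (G : Fin (d + 1) → Matrix (Fin (n + 1)) (Fin (n + 1)) k) (j : Fin (n + 1)) :
    (bundleCoord f G l m φ (Sum.inr j)).IsHomogeneous (e * 2 * d + e + 2) := by
  have hA : (rename Sum.inl (aeval φ l) :
      MvPolynomial (Fin (N + 1) ⊕ Fin (n + 1)) k).IsHomogeneous (e * 2) :=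
    (hl.aeval _ he).rename_isHomogeneous
  have hB : (rename Sum.inl (aeval φ m) :
      MvPolynomial (Fin (N + 1) ⊕ Fin (n + 1)) k).IsHomogeneous (e * 2) :=
    (hm.aeval _ he).rename_isHomogeneous
  have hAB : ∀ t : Fin (d + 1), (rename Sum.inl (aeval φ l) ^ (d - (t : ℕ)) *
      rename Sum.inl (aeval φ m) ^ (t : ℕ) :
        MvPolynomial (Fin (N + 1) ⊕ Fin (n + 1)) k).IsHomogeneous (e * 2 * d) := by
    intro t
    have := (hA.pow (d - (t : ℕ))).mul (hB.pow (t : ℕ))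
    rwa [← mul_add, Nat.sub_add_cancel (Nat.lt_succ_iff.mp t.2)] at this
  have hV : (genericValue f l m φ).IsHomogeneous (e * 2 * d + 2) :=
    IsHomogeneous.sum _ _ _ fun t _ => (hAB t).mul (hf t).rename_isHomogeneous
  have hP : (genericPolar G l m φ).IsHomogeneous (e * 2 * d + 0 + (e + 1)) :=
    IsHomogeneous.sum _ _ _ fun i _ => IsHomogeneous.sum _ _ _ fun j _ =>
      (IsHomogeneous.sum _ _ _ fun t _ => (hAB t).mul (isHomogeneous_C _ _)).mul
        ((he i).rename_isHomogeneous.mul (isHomogeneous_X k _))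
  refine IsHomogeneous.sub ?_ ?_
  · have := hV.mul ((he j).rename_isHomogeneous (f := (Sum.inl : _ → Fin (N + 1) ⊕ Fin (n + 1))))
    rwa [show e * 2 * d + 2 + e = e * 2 * d + e + 2 by ring] at this
  · have := ((isHomogeneous_C (Fin (N + 1) ⊕ Fin (n + 1)) (2 : k)).mul hP).mul
      (isHomogeneous_X k (Sum.inr j))
    rwa [show 0 + (e * 2 * d + 0 + (e + 1)) + 1 = e * 2 * d + e + 2 by ring] at this

namespace IsColumnParametrization

/-- The rational map `bundleCoord` lands in the divisor. -/
theorem aeval_bundleCoord_divisorForm (h : IsColumnParametrization f z l m φ)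
    {G : Fin (d + 1) → Matrix (Fin (n + 1)) (Fin (n + 1)) k} (hGs : ∀ t, (G t).transpose = G t)
    (hG : ∀ t, f t = ∑ i, ∑ j, C (G t i j) * (X i * X j)) :
    aeval (bundleCoord f G l m φ) (divisorForm f) = 0 := by
  rw [aeval_divisorForm, sum_aeval_eq_bundleGram hG]
  simp only [bundleCoord, Sum.elim_inl, Sum.elim_inr, Matrix.cons_val_zero, Matrix.cons_val_one]
  refine isotropic_residual (bundleGram_symm hGs _ _)
    (v := fun i => rename Sum.inl (φ i)) (w := fun j => X (Sum.inr j)) ?_ ?_ rfl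
  · rw [← sum_aeval_eq_bundleGram hG]
    have h1 := h.aeval_column (rename (Sum.inl : _ → Fin (N + 1) ⊕ Fin (n + 1))) 1
    simp only [one_mul, one_pow] at h1
    have h2 := aeval_divisorForm_of_columns (v := Sum.elim
      ![rename (Sum.inl : _ → Fin (N + 1) ⊕ Fin (n + 1)) (aeval φ l), rename Sum.inl (aeval φ m)]
        fun j => rename Sum.inl (φ j)) h1
    rw [aeval_divisorForm] at h2
    simp only [Sum.elim_inl, Sum.elim_inr, Matrix.cons_val_zero, Matrix.cons_val_one] at h2
    rw [h2]
    ring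
  · rw [← sum_aeval_eq_bundleGram hG, genericValue]
    refine Finset.sum_congr rfl fun t _ => ?_
    rw [rename_eq_aeval (R := k) (Sum.inr : Fin (n + 1) → Fin (N + 1) ⊕ Fin (n + 1))]
    rfl

/-- The polar form of `φ` has degree at most one in `y`, against two for the quadric, and is
non-zero because `φ` is not a vertex. -/
theorem not_dvd_genericPolar (h : IsColumnParametrization f z l m φ) (h2 : (2 : k) ≠ 0)
    {G : Fin (d + 1) → Matrix (Fin (n + 1)) (Fin (n + 1)) k} (hGs : ∀ t, (G t).transpose = G t)
    (hG : ∀ t, f t = ∑ i, ∑ j, C (G t i j) * (X i * X j))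
    {a b : MvPolynomial (Fin (N + 1)) k} (hab : bundlePoly f a b ≠ 0) :
    ¬ bundlePoly f a b ∣ iterate k _ _ (2 * genericPolar G l m φ) := by
  classical
  obtain ⟨i, hi⟩ := h.exists_polar_ne_zero hGs hG
  have hsymm := bundleGram_symm hGs (aeval φ l) (aeval φ m)
  have hi' : ∑ j, bundleGram G (aeval φ l) (aeval φ m) j i * φ j ≠ 0 := by
    convert hi using 3 with j
    exact congrFun (congrFun hsymm i) j
  have hne : iterate k _ _ (genericPolar G l m φ) ≠ 0 := by
    intro h0
    rw [iterate_genericPolar] at h0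
    have := congrArg (coeff (Finsupp.single i 1)) h0
    simp only [coeff_sum, coeff_C_mul, coeff_X, coeff_zero, Finsupp.single_left_inj one_ne_zero,
      mul_ite, mul_one, mul_zero, Finset.sum_ite_eq', Finset.mem_univ, if_true] at this
    exact hi' this
  have hle : (iterate k _ _ (genericPolar G l m φ)).totalDegree ≤ 1 := by
    rw [iterate_genericPolar]
    refine totalDegree_finsetSum_le fun j _ => (totalDegree_mul _ _).trans ?_
    rw [totalDegree_C, totalDegree_X]
  have h2' : IsUnit (iterate k (Fin (N + 1)) (Fin (n + 1)) 2) := by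
    have := (isUnit_iff_ne_zero.mpr h2).map
      (algebraMap k (MvPolynomial (Fin (n + 1)) (MvPolynomial (Fin (N + 1)) k)))
    rw [map_ofNat] at this ⊢
    exact this
  intro hdvd
  rw [map_mul, h2'.dvd_mul_left] at hdvd
  have := totalDegree_le_of_dvd_of_isDomain hdvd hne
  rw [(isHomogeneous_bundlePoly h.isHomogeneous a b).totalDegree hab] at this
  omega

end IsColumnParametrization

end BundleParametrization

/-! ### Unirationality of the quadric bundle -/

section BundleUnirational

variable {k : Type*} [Field k] {n d N : ℕ} {f : Fin (d + 1) → MvPolynomial (Fin (n + 1)) k}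
  {z : Fin d → k} {l m : MvPolynomial (Fin (n + 1)) k}
  {φ : Fin (n + 1) → MvPolynomial (Fin (N + 1)) k}
  {G : Fin (d + 1) → Matrix (Fin (n + 1)) (Fin (n + 1)) k}

/-- At a point where the quadratic form vanishes and the polar form does not, the parametrisation
is the identity, so that the equations of its image vanish there. -/
theorem aeval_generic_eq_zero {Q : Type*} [CommRing Q] [IsDomain Q] [Algebra k Q]
    (κ : MvPolynomial (Fin (N + 1) ⊕ Fin (n + 1)) k →ₐ[k] Q)
    (hV : κ (genericValue f l m φ) = 0) (hP : κ (2 * genericPolar G l m φ) ≠ 0)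
    {p : MvPolynomial (Fin 2 ⊕ Fin (n + 1)) k}
    (hp : aeval (fun s => (X (Sum.inl (biprojBlock n s)) * rename Sum.inr (bundleCoord f G l m φ s) :
      MvPolynomial (Fin 2 ⊕ (Fin (N + 1) ⊕ Fin (n + 1))) k)) p = 0) :
    aeval (Sum.elim ![Polynomial.X * Polynomial.C (κ (rename Sum.inl (aeval φ l))),
      Polynomial.X * Polynomial.C (κ (rename Sum.inl (aeval φ m)))]
        fun j => Polynomial.C (κ (X (Sum.inr j)))) p = 0 := by
  let v : Fin 2 ⊕ Fin (n + 1) → Polynomial (Polynomial Q) := Sum.elim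
    ![Polynomial.C (Polynomial.X * Polynomial.C (κ (rename Sum.inl (aeval φ l)))),
      Polynomial.C (Polynomial.X * Polynomial.C (κ (rename Sum.inl (aeval φ m))))]
        fun j => Polynomial.X * Polynomial.C (Polynomial.C (κ (X (Sum.inr j))))
  have hr : (-Polynomial.C (κ (2 * genericPolar G l m φ)) : Polynomial Q) ≠ 0 :=
    neg_ne_zero.mpr (Polynomial.C_ne_zero.mpr hP)
  have h1 := aeval_param_eq_zero hp ![Polynomial.C Polynomial.X, Polynomial.X]
    (((Polynomial.CAlgHom (R := k) (A := Polynomial Q)).comp Polynomial.CAlgHom).comp κ)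
  -- Where the value of the form is zero, the residual point is the generic point times `-2` times
  -- the polar form. This non-zero factor is absorbed by the free scaling parameter, which is then
  -- set to 1.
  have h2 : (aeval v p).comp (Polynomial.C (-Polynomial.C (κ (2 * genericPolar G l m φ))) *
      Polynomial.X) = 0 := by
    rw [← h1]
    refine (comp_aeval_apply (f := v) ((Polynomial.aeval (R := Polynomial Q) (Polynomial.C
      (-Polynomial.C (κ (2 * genericPolar G l m φ))) * Polynomial.X)).restrictScalars k) p).trans ?_
    congr 2
    ext s : 1
    rcases s with s | j
    · fin_cases s
      · simp [v, biprojBlock, bundleCoord]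
        exact mul_comm _ _
      · simp [v, biprojBlock, bundleCoord]
        exact mul_comm _ _
    · simp [v, biprojBlock, bundleCoord, hV]
      ring
  have h3 := congrArg ((Polynomial.aeval (R := Polynomial Q) (1 : Polynomial Q)).restrictScalars k)
    (eq_zero_of_comp_eq_zero hr h2)
  rw [map_zero, comp_aeval_apply] at h3
  rw [← h3]
  congr 2
  ext s : 1
  rcases s with s | j
  · fin_cases s <;> simp [v]
  · simp [v]

/-- The equation of the quadric divides what vanishes modulo it. -/
theorem C_dvd_of_map_mk_eq_zero {W : Type*} [CommRing W] {F : W} {P : Polynomial W}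
    (h : P.map (Ideal.Quotient.mk (Ideal.span {F})) = 0) : Polynomial.C F ∣ P := by
  rw [Polynomial.C_dvd_iff_dvd_coeff]
  intro i
  have := congrArg (fun P => Polynomial.coeff P i) h
  simp only [Polynomial.coeff_map, Polynomial.coeff_zero] at this
  rwa [Ideal.Quotient.eq_zero_iff_mem, Ideal.mem_span_singleton] at this

/-- The coordinates of the generic point of the cone over the line and of the generic point of
the space. -/
noncomputable def conePoint (l m : MvPolynomial (Fin (n + 1)) k)
    (φ : Fin (n + 1) → MvPolynomial (Fin (N + 1)) k) : Fin 2 ⊕ Fin (n + 1) →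
      Polynomial (MvPolynomial (Fin (n + 1)) (MvPolynomial (Fin (N + 1)) k)) :=
  Sum.elim ![Polynomial.X * Polynomial.C (C (aeval φ l)),
    Polynomial.X * Polynomial.C (C (aeval φ m))] fun j => Polynomial.C (X j)

theorem map_aeval_conePoint {Q : Type*} [CommRing Q] [Algebra k Q]
    (g : MvPolynomial (Fin (n + 1)) (MvPolynomial (Fin (N + 1)) k) →ₐ[k] Q)
    (p : MvPolynomial (Fin 2 ⊕ Fin (n + 1)) k) :
    (aeval (conePoint l m φ) p).map (g : _ →+* Q) = aeval (Sum.elim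
      ![Polynomial.X * Polynomial.C ((g.comp (iterate k _ _)) (rename Sum.inl (aeval φ l))),
        Polynomial.X * Polynomial.C ((g.comp (iterate k _ _)) (rename Sum.inl (aeval φ m)))]
          fun j => Polynomial.C ((g.comp (iterate k _ _)) (X (Sum.inr j)))) p := by
  refine (comp_aeval_apply (f := conePoint l m φ) (Polynomial.mapAlgHom g) p).trans ?_
  congr 2
  ext s : 1
  rcases s with s | j
  · fin_cases s <;> simp [conePoint, ← iterate_rename_inl]
  · simp [conePoint, iterate]

namespace IsColumnParametrization

/-- Since `λ(φ) T` and `μ(φ) T` are algebraically independent, `k[x_0, x_1]` embeds in `E`. There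
the equation of the divisor becomes the form over `(a, b)` times the unit `(T c) ^ d`, so
divisibility over `E` descends. -/
theorem divisorForm_dvd (h : IsColumnParametrization f z l m φ)
    {a b c : MvPolynomial (Fin (N + 1)) k} (ha : c * a = aeval φ l) (hb : c * b = aeval φ m)
    {E : Type*} [Field E] [Algebra k E] {α : Polynomial (MvPolynomial (Fin (N + 1)) k) →ₐ[k] E}
    (hα : Function.Injective α) {p : MvPolynomial (Fin 2 ⊕ Fin (n + 1)) k}
    (hdvd : Polynomial.C (bundlePoly f a b) ∣ aeval (conePoint l m φ) p) : divisorForm f ∣ p := by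
  let g : MvPolynomial (Fin 2) k →ₐ[k] E := α.comp (aeval
    ![Polynomial.X * Polynomial.C (aeval φ l), Polynomial.X * Polynomial.C (aeval φ m)])
  have hg : Function.Injective g := by
    refine hα.comp ((injective_iff_map_eq_zero _).mpr fun G hG => h.binary_eq_zero hG)
  let β : MvPolynomial (Fin (N + 1)) k →ₐ[k] E := α.comp Polynomial.CAlgHom
  let Θ : Polynomial (MvPolynomial (Fin (n + 1)) (MvPolynomial (Fin (N + 1)) k)) →+*
      MvPolynomial (Fin (n + 1)) E :=
    Polynomial.eval₂RingHom (map (β : MvPolynomial (Fin (N + 1)) k →+* E)) (C (α Polynomial.X))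
  have hΘC : ∀ P, Θ (Polynomial.C P) = map (β : MvPolynomial (Fin (N + 1)) k →+* E) P :=
    fun P => Polynomial.eval₂_C _ _
  have hΘX : Θ Polynomial.X = C (α Polynomial.X) := Polynomial.eval₂_X _ _
  have hΘ : Θ (aeval (conePoint l m φ) p) = map g.toRingHom (iterate k _ _ p) := by
    have : Θ.comp (aeval (conePoint l m φ) : _ →ₐ[k] _).toRingHom =
        (map g.toRingHom).comp (iterate k _ _).toRingHom := by
      apply MvPolynomial.ringHom_ext
      · intro r
        simp [iterate, hΘC, MvPolynomial.algebraMap_apply, Polynomial.algebraMap_apply]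
      · rintro (i | j)
        · fin_cases i <;> simp [conePoint, iterate, hΘC, hΘX, g, β]
        · simp [conePoint, iterate, hΘC]
    exact RingHom.congr_fun this p
  refine divisorForm_dvd_of_map_dvd h.linearIndependent hg ?_
  rw [← hΘ]
  refine dvd_trans ?_ (map_dvd Θ hdvd)
  rw [hΘC, map_bundlePoly β]
  have hgX : ∀ x y : MvPolynomial (Fin (N + 1)) k, c * x = y →
      α (Polynomial.X * Polynomial.C y) = (α Polynomial.X * β c) * β x := by
    rintro x y rfl
    simp only [map_mul, β, AlgHom.comp_apply, Polynomial.CAlgHom_apply]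
    ring
  have hg0 : g (X 0) = (α Polynomial.X * β c) * β a := by
    simp only [g, AlgHom.comp_apply, aeval_X, Matrix.cons_val_zero]
    exact hgX _ _ ha
  have hg1 : g (X 1) = (α Polynomial.X * β c) * β b := by
    simp only [g, AlgHom.comp_apply, aeval_X, Matrix.cons_val_one]
    exact hgX _ _ hb
  rw [hg0, hg1, bundlePoly_mul]
  have hne : α Polynomial.X * β c ≠ 0 := by
    intro h0
    rw [h0, zero_mul] at hg0
    exact X_ne_zero (R := k) (0 : Fin 2) (hg (hg0.trans (map_zero g).symm))
  exact (((isUnit_iff_ne_zero.mpr (pow_ne_zero d hne)).map C).mul_left_dvd).mpr dvd_rfl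

theorem mem_span_divisorForm_iff (h : IsColumnParametrization f z l m φ) (h2 : (2 : k) ≠ 0)
    (hGs : ∀ t, (G t).transpose = G t)
    (hG : ∀ t, f t = ∑ i, ∑ j, C (G t i j) * (X i * X j))
    {a b c : MvPolynomial (Fin (N + 1)) k} (hab : IsRelPrime a b) (ha : c * a = aeval φ l)
    (hb : c * b = aeval φ m) (p : MvPolynomial (Fin 2 ⊕ Fin (n + 1)) k) :
    p ∈ Ideal.span {divisorForm f} ↔
      aeval (fun s => (X (Sum.inl (biprojBlock n s)) * rename Sum.inr (bundleCoord f G l m φ s) :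
        MvPolynomial (Fin 2 ⊕ (Fin (N + 1) ⊕ Fin (n + 1))) k)) p = 0 := by
  have hprime := h.prime_bundlePoly hab ha hb
  have hval : iterate k _ _ (genericValue f l m φ) = C (c ^ d) * bundlePoly f a b := by
    rw [iterate_genericValue, ← ha, ← hb, bundlePoly_mul]
  rw [Ideal.mem_span_singleton]
  constructor
  · rintro ⟨q, rfl⟩
    rw [map_mul]
    refine mul_eq_zero_of_left ?_ _
    have h3 := h.aeval_bundleCoord_divisorForm hGs hG
    have h4 := congrArg (rename (Sum.inr : _ → Fin 2 ⊕ (Fin (N + 1) ⊕ Fin (n + 1)))) h3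
    rw [map_zero, comp_aeval_apply, aeval_divisorForm] at h4
    rw [aeval_divisorForm]
    simp only [biprojBlock, Sum.elim_inl, Sum.elim_inr]
    simp only [aeval_mul_of_isHomogeneous (h.isHomogeneous _)]
    have h5 := congrArg (fun q => X (Sum.inl 0) ^ d * X (Sum.inl 1) ^ 2 * q) h4
    simp only [mul_zero, Finset.mul_sum] at h5
    rw [← h5]
    refine Finset.sum_congr rfl fun t _ => ?_
    have ht : (X (Sum.inl 0) : MvPolynomial (Fin 2 ⊕ (Fin (N + 1) ⊕ Fin (n + 1))) k) ^ d =
        X (Sum.inl 0) ^ (d - (t : ℕ)) * X (Sum.inl 0) ^ (t : ℕ) := by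
      rw [← pow_add, Nat.sub_add_cancel (Nat.lt_succ_iff.mp t.2)]
    rw [ht]
    ring
  · intro hp
    have hI : (Ideal.span {bundlePoly f a b}).IsPrime :=
      (Ideal.span_singleton_prime hprime.ne_zero).mpr hprime
    let mk := Ideal.Quotient.mkₐ k (Ideal.span {bundlePoly f a b})
    have hmk : ∀ P, mk P = 0 ↔ bundlePoly f a b ∣ P := fun P => by
      rw [← Ideal.mem_span_singleton]
      exact Ideal.Quotient.eq_zero_iff_mem
    -- The residual-point map is evaluated at the generic point of the quadric itself, that is, in
    -- the coordinate ring modulo the prime form over `(a, b)`.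
    have hp1 := aeval_generic_eq_zero (mk.comp (iterate k (Fin (N + 1)) (Fin (n + 1))))
      (f := f) (G := G) (l := l) (m := m) (φ := φ)
      ((hmk _).mpr (hval ▸ dvd_mul_left _ _))
      (fun h0 => h.not_dvd_genericPolar h2 hGs hG hprime.ne_zero ((hmk _).mp h0)) hp
    let α := IsScalarTower.toAlgHom k (Polynomial (MvPolynomial (Fin (N + 1)) k))
      (FractionRing (Polynomial (MvPolynomial (Fin (N + 1)) k)))
    refine h.divisorForm_dvd ha hb (α := α) (IsFractionRing.injective _ _)
      (C_dvd_of_map_mk_eq_zero ?_)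
    rw [← hp1]
    exact map_aeval_conePoint mk p

theorem bundle_unirational (h : IsColumnParametrization f z l m φ) (h2 : (2 : k) ≠ 0) :
    IsUnirational (biprojBlock n) (Ideal.span {divisorForm f}) := by
  choose G hGs hG using fun t => exists_gram h2 (h.isHomogeneous t)
  obtain ⟨a, b, c, hab, ha, hb⟩ :=
    UniqueFactorizationMonoid.exists_reduced_factors _ h.l_ne_zero (aeval φ m)
  obtain ⟨e, he⟩ := h.exists_degree
  have hne := (h.prime_bundlePoly hab ha hb).ne_zero
  refine (isUnirational_of_parametrization (φ := bundleCoord f G l m φ) (fun i => ?_)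
    (h.mem_span_divisorForm_iff h2 hGs hG hab ha hb)).2
  have hinj : Function.Injective (rename (R := k) (Sum.inl : Fin (N + 1) → _ ⊕ Fin (n + 1))) :=
    rename_injective _ Sum.inl_injective
  fin_cases i
  · refine ⟨⟨e * 2, ?_⟩, Sum.inl 0, rfl, ?_⟩
    · rintro (s | j) hs
      · fin_cases s
        · exact (h.isHomogeneous_l.aeval _ he).rename_isHomogeneous
        · exact (h.isHomogeneous_m.aeval _ he).rename_isHomogeneous
      · exact absurd hs (by simp [biprojBlock])
    · exact (map_ne_zero_iff _ hinj).mpr h.l_ne_zero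
  · refine ⟨⟨e * 2 * d + e + 2, ?_⟩, Sum.inr 0, rfl, fun h0 => ?_⟩
    · rintro (s | j) hs
      · exact absurd hs (by simp [biprojBlock])
      · exact bundleCoord_isHomogeneous he h.isHomogeneous h.isHomogeneous_l h.isHomogeneous_m G j
    · have h1 := congrArg (iterate k _ _) h0
      have hX : iterate k (Fin (N + 1)) (Fin (n + 1)) (X (Sum.inr 0)) = X 0 := by simp [iterate]
      rw [bundleCoord, Sum.elim_inr, map_sub, map_mul, map_mul (iterate _ _ _) (2 * _), map_zero,
        sub_eq_zero, hX, iterate_genericValue, ← ha, ← hb, bundlePoly_mul] at h1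
      -- If this coordinate were zero, the prime form would divide `2` times the polar form times
      -- `y_0`; both factors have degree at most one in `y`.
      have h3 : bundlePoly f a b ∣ iterate k _ _ (2 * genericPolar G l m φ) * X 0 :=
        h1 ▸ ((dvd_mul_left _ _).mul_right _)
      rcases (h.prime_bundlePoly hab ha hb).dvd_or_dvd h3 with h4 | h4
      · exact h.not_dvd_genericPolar h2 hGs hG hne h4
      · have := totalDegree_le_of_dvd_of_isDomain h4 (X_ne_zero _)
        rw [(isHomogeneous_bundlePoly h.isHomogeneous a b).totalDegree hne, totalDegree_X] at this
        omega

end IsColumnParametrization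

end BundleUnirational

theorem mainTheorem8 {k : Type*} [Field k] (h2 : (2 : k) ≠ 0) {n d : ℕ} (hd : 1 < d) (hdn : d < n)
    (f : Fin (d + 1) → MvPolynomial (Fin (n + 1)) k) (hf : ∀ i, (f i).IsHomogeneous 2)
    (hlin : LinearIndependent k f)
    (z : Fin d → k) (hz : z ≠ 0)
    (hci : IsCompleteIntersectionOfQuadrics (minorIdeal f z) (d - 1))
    (huni : IsUnirational (projBlock n) (minorIdeal f z)) :
    IsUnirational (biprojBlock n) (Ideal.span {divisorForm f}) ∧
      (Ideal.span {divisorForm f} ≤ strictTransformIdeal f z ∧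
        IsUnirational (biprojBlock n) (strictTransformIdeal f z) ∧
        DominatesLine (strictTransformIdeal f z)) := by
  obtain ⟨hsat, hdeg, l, m, hl, hm, hcol, hind⟩ := normalForm hd hf hlin hz hci
  obtain ⟨-, N, φ, hφ, himg⟩ := huni
  obtain ⟨⟨e, he⟩, j, -, hj⟩ := hφ ()
  have h : IsColumnParametrization f z l m φ :=
    { one_lt := hd
      isHomogeneous := hf
      linearIndependent := hlin
      ne_zero := hz
      isHomogeneous_l := hl
      isHomogeneous_m := hm
      column := hcol
      independent := hind
      eq_zero := hdeg
      exists_degree := ⟨e, fun j => he j rfl⟩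
      exists_ne_zero := ⟨j, hj⟩
      mem_iff := fun p => by
        rw [← hsat, ← himg]
        exact RingHom.mem_ker }
  exact ⟨h.bundle_unirational h2, (le_sup_left.trans le_sup_left).trans (le_saturationAlong _ _),
    h.strictTransform_unirational.2, h.strictTransform_dominatesLine⟩
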